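/- **Setting.** Let $\mathcal A$ be a finite alphabet. A substitution $\varrho$ maps letters to non-empty words and is extended to words by concatenation. A word is *admitted* if it is a subword of some $\varrho^n(c)$ with $c\in\mathcal A$, $n\ge 1$. Let $\mathbb X_\varrho\subset\mathcal A^{\mathbb Z}$ be the set of bi-infinite sequences all of whose subwords are admitted; a word is *legal* if it occurs in some $w\in\mathbb X_\varrho$. We call $\varrho$ *almost primitive* if there is a unique letter $a$ with $\varrho(a)=a^p$ for some $p\ge1$; there is a $k$ such that every letter occurs in $\varrho^k(c)$ for every $c\ne a$; and $a^n$ is legal for all $n$. The letters $c\neq a$ are called *primitive*. Let $\nu$ denote any non-atomic shift-invariant Borel measure carried by $\mathbb X_\varrho$ that is finite on every clopen set not containing $a^{\mathbb Z}$; for $\mathcal A$, $\varrho$ as above (apart from the degenerate case $\mathcal A=\{a,b\}$, $\varrho(b)=a^sba^t$) it is known that such a measure $\nu\neq0$ exists and is unique up to scaling. It may be infinite. For $V\colon\mathcal A\to\mathbb R$ and $w\in\mathcal A^{\mathbb Z}$ let $H_w$ be the operator on $\ell^2(\mathbb Z)$ given by $(H_w\psi)_n=\psi_{n-1}+\psi_{n+1}+V(w_n)\psi_n$.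 For integers $p\ge1$, $r\ge2$, $k_1,\dots,k_r\ge0$ with $\sum_i k_i>0$ and ($p>1$ or $k_r>0$), let $\varrho_{p,k}$ be the substitution on $\{a,b\}$ given by $a\mapsto a^p$, $b\mapsto ba^{k_1}ba^{k_2}\cdots ba^{k_r}$. Put $f(k)=k_r+pk$, $\mathcal N=\{k\ge 0: ba^kb \text{ is legal}\}$, $k_{\max}=\max\{k_1,\dots,k_{r-1}\}$. Let $\beta^{(0)}$ be the empty word, and $\beta^{(n+1)}=\beta^{(n)}f^n(k_1)\beta^{(n)}f^n(k_2)\cdots\beta^{(n)}f^n(k_{r-1})\beta^{(n)}$ (a word over the alphabet $\mathbb N_0$). Let $\bar\varrho$ be the return word substitution $k\mapsto k_1\cdots k_{r-1}f(k)$ on the one-point compactification $\mathcal N\cup\{\infty\}$, with $f(\infty)=\infty$; a word is admitted by $\bar\varrho$ if it is a subword of some $\bar\varrho^n(k)$, $n\ge1$, or a limit of such subwords; $\mathbb X_{\bar\varrho}$ consists of the bi-infinite sequences all of whose subwords are admitted, and $\mathcal L'_{\bar\varrho}$ is the set of non-empty words over $\mathcal N$ (without the letter $\infty$) occurring in elements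 of $\mathbb X_{\bar\varrho}$. **Theorem.** 1. Let $\varrho$ be almost primitive and suppose that there is a word $u=u_1\cdots u_m$ with $m\ge1$ such that $u_1$ is primitive and $uuuu_1$ is legal. Then for every $V$ and every $\nu$ as above, $H_w$ has no eigenvalues for $\nu$-almost every $w$. 2. Let $\varrho=\varrho_{p,k}$ and suppose that $(\ast)$ there are a non-empty word $v$ over $\{a,b\}$ and $w'\in\mathbb X_\varrho$ such that $bvbvbvb$ occurs in $w'$. Then for every $V$ and every $\nu$ as above, $H_w$ has no eigenvalues (its pure point spectrum is empty) for $\nu$-almost every $w$. 3. For $\varrho=\varrho_{p,k}$ the following are equivalent: (i) property $(\ast)$; (ii) there is a word $u$ with $u_1=b$ and $uuuu_1$ legal; (iii) there is $v\in\mathcal L'_{\bar\varrho}$ with $|v|<r$ such that $vvv$ is a subword of $\beta^{(2)}$, or of $\beta^{(2)}k\beta^{(2)}$ for some $k\in f^2(\mathcal N)$ with $k\le k_{\max}$; (iv) there is a non-empty word $v$ over $\mathbb N_0$ with the properties in (iii), apart from $v\in\mathcal L'_{\bar\varrho}$. 4. Property $(\ast)$ can be decided algorithmically: there is one computable function that takes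 the parameters $p,(k_1,\dots,k_r)$ as above as input and returns whether $\varrho_{p,k}$ satisfies $(\ast)$. -/

import Mathlib

open MeasureTheory

namespace SubstSchr

/-! ### Words, substitutions and their subshifts -/

section Words

variable {𝒜 : Type*}

/-- The word `w_j w_{j+1} ⋯ w_{j+n-1}` of a bi-infinite sequence `w`. -/
def window (w : ℤ → 𝒜) (j : ℤ) (n : ℕ) : List 𝒜 :=
  List.ofFn fun i : Fin n => w (j + (i : ℕ))

/-- The word `v` occurs in (is a subword of) the bi-infinite sequence `w`. -/
def Occurs (v : List 𝒜) (w : ℤ → 𝒜) : Prop :=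
  ∃ j : ℤ, window w j v.length = v

/-- The left shift on bi-infinite sequences. -/
def shift (w : ℤ → 𝒜) : ℤ → 𝒜 := fun n => w (n + 1)

/-- `ϱ^n(u)`: the substitution `ϱ`, extended to words by concatenation and applied `n` times. -/
def substIter (ϱ : 𝒜 → List 𝒜) (n : ℕ) (u : List 𝒜) : List 𝒜 :=
  (fun x : List 𝒜 => x.flatMap ϱ)^[n] u

/-- A word is admitted by `ϱ` if it is a subword of some `ϱ^n(c)` with `c` a letter, `n ≥ 1`. -/
def Admitted (ϱ : 𝒜 → List 𝒜) (v : List 𝒜) : Prop :=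
  ∃ (c : 𝒜) (n : ℕ), 0 < n ∧ v <:+: substIter ϱ n [c]

/-- The subshift `𝕏_ϱ`: all bi-infinite sequences all of whose subwords are admitted. -/
def subshift (ϱ : 𝒜 → List 𝒜) : Set (ℤ → 𝒜) :=
  {w | ∀ (j : ℤ) (n : ℕ), Admitted ϱ (window w j n)}

/-- A word is legal (belongs to the language of `ϱ`) if it occurs in some element of `𝕏_ϱ`. -/
def Legal (ϱ : 𝒜 → List 𝒜) (v : List 𝒜) : Prop :=
  ∃ w ∈ subshift ϱ, Occurs v w

/-- `ϱ` is an almost primitive substitution with non-primitive letter `a`. -/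
structure IsAlmostPrimitive (ϱ : 𝒜 → List 𝒜) (a : 𝒜) : Prop where
  /-- substitutions map letters to non-empty words -/
  image_ne_nil : ∀ c, ϱ c ≠ []
  /-- `ϱ(a) = a^p` for some `p ≥ 1` -/
  map_a : ∃ p : ℕ, 0 < p ∧ ϱ a = List.replicate p a
  /-- `a` is the only letter with that property -/
  unique_a : ∀ c : 𝒜, (∃ q : ℕ, 0 < q ∧ ϱ c = List.replicate q c) → c = a
  /-- for some `k`, every letter occurs in `ϱ^k(c)` whenever `c ≠ a` -/
  primitive : ∃ k : ℕ, ∀ b c : 𝒜, c ≠ a → b ∈ substIter ϱ k [c]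
  /-- all powers of `a` are legal -/
  pow_legal : ∀ n : ℕ, Legal ϱ (List.replicate n a)

/-- There is a word `u` whose first letter `c` is primitive (that is, `c ≠ a`) and such that
`u u u c` is legal. -/
def HasCubePlus (ϱ : 𝒜 → List 𝒜) (a : 𝒜) : Prop :=
  ∃ (c : 𝒜) (t : List 𝒜), c ≠ a ∧
    Legal ϱ ((c :: t) ++ (c :: t) ++ (c :: t) ++ [c])

/-- The defining properties of the (up to scaling unique) measure `ν`: it is a non-atomic
shift-invariant Borel measure, carried by `𝕏_ϱ`, possibly infinite, but finite on every clopen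
set that does not contain the fixed point `a^ℤ`. -/
structure IsNonatomicInvariant [TopologicalSpace 𝒜] [MeasurableSpace 𝒜]
    (ϱ : 𝒜 → List 𝒜) (a : 𝒜) (ν : Measure (ℤ → 𝒜)) : Prop where
  carried : ν (subshift ϱ)ᶜ = 0
  invariant : MeasurePreserving shift ν ν
  nonatomic : ∀ w, ν {w} = 0
  finite_of_clopen : ∀ C : Set (ℤ → 𝒜), IsClopen C → (fun _ => a) ∉ C → ν C < ⊤

end Words

/-! ### The Schrödinger operator -/

section Operator

variable {𝒜 : Type*}

/-- The Hilbert space `ℓ²(ℤ)`. -/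
abbrev Ell2 : Type := lp (fun _ : ℤ => ℂ) 2

theorem memlp_comp_equiv {ψ : ℤ → ℂ} (hψ : Memℓp ψ 2) (e : ℤ ≃ ℤ) :
    Memℓp (fun n => ψ (e n)) 2 := by
  have h2 : 0 < (2 : ENNReal).toReal := by norm_num
  rw [memℓp_gen_iff h2] at hψ ⊢
  exact (e.summable_iff (f := fun n => ‖ψ n‖ ^ (2 : ENNReal).toReal)).2 hψ

theorem memlp_schroedinger [Finite 𝒜] (V : 𝒜 → ℝ) (w : ℤ → 𝒜) {ψ : ℤ → ℂ}
    (hψ : Memℓp ψ 2) :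
    Memℓp (fun n => ψ (n - 1) + ψ (n + 1) + (V (w n) : ℂ) * ψ n) 2 := by
  have h2 : 0 < (2 : ENNReal).toReal := by norm_num
  have h1 : Memℓp (fun n => ψ (n - 1)) 2 := memlp_comp_equiv hψ (Equiv.subRight 1)
  have h3 : Memℓp (fun n => ψ (n + 1)) 2 := memlp_comp_equiv hψ (Equiv.addRight 1)
  have h4 : Memℓp (fun n => (V (w n) : ℂ) * ψ n) 2 := by
    obtain ⟨M, hM⟩ := (Set.finite_range fun c => |V c|).bddAbove
    have hb := hψ.const_mul (M : ℂ)
    rw [memℓp_gen_iff h2] at hb ⊢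
    refine Summable.of_nonneg_of_le (fun n => by positivity) (fun n => ?_) hb
    have hMn : |V (w n)| ≤ |M| := (hM ⟨w n, rfl⟩).trans (le_abs_self M)
    refine Real.rpow_le_rpow (norm_nonneg _) ?_ h2.le
    simp only [norm_mul, Complex.norm_real, Real.norm_eq_abs]
    exact mul_le_mul_of_nonneg_right hMn (norm_nonneg _)
  exact (h1.add h3).add h4

/-- The Schrödinger operator `(H_w ψ)_n = ψ_{n-1} + ψ_{n+1} + V(w_n) ψ_n` on `ℓ²(ℤ)`. -/
def H [Finite 𝒜] (V : 𝒜 → ℝ) (w : ℤ → 𝒜) : Ell2 →ₗ[ℂ] Ell2 where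
  toFun ψ := ⟨fun n => ψ (n - 1) + ψ (n + 1) + (V (w n) : ℂ) * ψ n,
    memlp_schroedinger V w (lp.memℓp ψ)⟩
  map_add' ψ φ := by
    ext n
    simp only [lp.coeFn_add, Pi.add_apply]
    ring
  map_smul' c ψ := by
    ext n
    simp only [lp.coeFn_smul, Pi.smul_apply, smul_eq_mul, RingHom.id_apply]
    ring

/-- `H_w` has no eigenvalues (equivalently, its pure point spectrum is empty). -/
def NoEigenvalues [Finite 𝒜] (V : 𝒜 → ℝ) (w : ℤ → 𝒜) : Prop :=
  ∀ E : ℂ, ¬ Module.End.HasEigenvalue (H V w) E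

end Operator

/-! ### The two-letter family `a ↦ a^p`, `b ↦ b a^{k_1} b a^{k_2} ⋯ b a^{k_r}` -/

/-- The alphabet `{a, b}`. -/
inductive Letter
  | a
  | b
  deriving DecidableEq

instance : Fintype Letter := ⟨{Letter.a, Letter.b}, fun c => by cases c <;> simp⟩

instance : TopologicalSpace Letter := ⊥
instance : DiscreteTopology Letter := ⟨rfl⟩
instance : MeasurableSpace Letter := ⊤
instance : DiscreteMeasurableSpace Letter := ⟨fun _ => trivial⟩

/-- The substitution `a ↦ a^p`, `b ↦ b a^{k_1} ⋯ b a^{k_r}`, where `ks = [k_1, …, k_r]`. -/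
def sub (p : ℕ) (ks : List ℕ) : Letter → List Letter
  | .a => List.replicate p .a
  | .b => ks.flatMap fun k => .b :: List.replicate k .a

/-- The standing assumptions on the parameters:
`p ≥ 1`, `r ≥ 2`, not all `k_i` vanish, and `p > 1` or `k_r > 0`. -/
def Admissible (p : ℕ) (ks : List ℕ) : Prop :=
  0 < p ∧ 2 ≤ ks.length ∧ 0 < ks.sum ∧ (1 < p ∨ 0 < ks.getLastD 0)

/-- Property `(∗)`: `b v b v b v b` occurs in some element of the subshift, for some non-empty
word `v`. -/
def PropStar (p : ℕ) (ks : List ℕ) : Prop :=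
  ∃ v : List Letter, v ≠ [] ∧ ∃ w' ∈ subshift (sub p ks),
    Occurs ([.b] ++ v ++ [.b] ++ v ++ [.b] ++ v ++ [.b]) w'

/-- The set `𝒩` of all `k` such that `b a^k b` is legal (the return word `b a^k` is coded by
the number `k`). -/
def retLetters (p : ℕ) (ks : List ℕ) : Set ℕ :=
  {k | Legal (sub p ks) (.b :: (List.replicate k .a ++ [.b]))}

/-- The affine function `f(k) = k_r + p k`. -/
def affine (p : ℕ) (ks : List ℕ) (k : ℕ) : ℕ := ks.getLastD 0 + p * k

/-- `k_max = max {k_1, …, k_{r-1}}`. -/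
def kMax (ks : List ℕ) : ℕ := ks.dropLast.foldr max 0

/-- The words `β^{(n)}`: `β^{(0)}` is empty and
`β^{(n+1)} = β^{(n)} f^n(k_1) ⋯ β^{(n)} f^n(k_{r-1}) β^{(n)}`. -/
def beta (p : ℕ) (ks : List ℕ) : ℕ → List ℕ
  | 0 => []
  | n + 1 => (ks.dropLast.flatMap fun j => beta p ks n ++ [(affine p ks)^[n] j]) ++ beta p ks n

/-- The one-point compactification `𝒩 ∪ {∞}`, inside that of `ℕ`. -/
def retLettersBar (p : ℕ) (ks : List ℕ) : Set (OnePoint ℕ) :=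
  insert OnePoint.infty ((fun k : ℕ => (k : OnePoint ℕ)) '' retLetters p ks)

/-- The return word substitution `k ↦ k_1 ⋯ k_{r-1} f(k)`, with `f(∞) = ∞`. -/
def retSub (p : ℕ) (ks : List ℕ) (k : OnePoint ℕ) : List (OnePoint ℕ) :=
  (ks.dropLast.map fun j : ℕ => (j : OnePoint ℕ)) ++ [OnePoint.map (affine p ks) k]

/-- The words `β^{(n)}` are characterised by `ϱ̄^n(k) = β^{(n)} f^n(k)`. -/
theorem substIter_retSub (p : ℕ) (ks : List ℕ) (n k : ℕ) :
    substIter (retSub p ks) n [(k : OnePoint ℕ)] =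
      ((beta p ks n ++ [(affine p ks)^[n] k]).map fun j : ℕ => (j : OnePoint ℕ)) := by
  have happ : ∀ (n : ℕ) (u v : List (OnePoint ℕ)), substIter (retSub p ks) n (u ++ v) =
      substIter (retSub p ks) n u ++ substIter (retSub p ks) n v := by
    intro n
    induction n with
    | zero => intro u v; rfl
    | succ n ih =>
      intro u v
      simp only [substIter, Function.iterate_succ, Function.comp] at ih ⊢
      rw [List.flatMap_append, ih]
  have hnil : ∀ n : ℕ, substIter (retSub p ks) n [] = [] := by
    intro n
    induction n with
    | zero => rfl
    | succ n ih => simpa [substIter, Function.iterate_succ] using ih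
  induction n generalizing k with
  | zero => simp [substIter, beta]
  | succ n ih =>
    have hl : ∀ l : List ℕ,
        substIter (retSub p ks) n (l.map fun j : ℕ => (j : OnePoint ℕ)) =
        ((l.flatMap fun j => beta p ks n ++ [(affine p ks)^[n] j]).map
          fun j : ℕ => (j : OnePoint ℕ)) := by
      intro l
      induction l with
      | nil => simpa using hnil n
      | cons x l ihl =>
        have : ((x :: l).map fun j : ℕ => (j : OnePoint ℕ)) =
            [(x : OnePoint ℕ)] ++ l.map fun j : ℕ => (j : OnePoint ℕ) := rfl
        rw [this, happ, ih, ihl]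
        simp
    have hstep : substIter (retSub p ks) (n + 1) [(k : OnePoint ℕ)] =
        substIter (retSub p ks) n ((ks.dropLast ++ [affine p ks k]).map
          fun j : ℕ => (j : OnePoint ℕ)) := by
      simp [substIter, retSub, Function.iterate_succ]
    rw [hstep, hl]
    simp [beta, Function.iterate_succ]

/-- Words of length `n` admitted by the return word substitution: subwords of `ϱ̄^m(k)` with
`k ∈ 𝒩 ∪ {∞}`, `m ≥ 1`, and limits of such subwords. -/
def retAdmitted (p : ℕ) (ks : List ℕ) (n : ℕ) : Set (Fin n → OnePoint ℕ) :=
  closure {u | ∃ k ∈ retLettersBar p ks, ∃ m : ℕ, 0 < m ∧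
    List.ofFn u <:+: substIter (retSub p ks) m [k]}

/-- The subshift of the return word substitution. -/
def retSubshift (p : ℕ) (ks : List ℕ) : Set (ℤ → OnePoint ℕ) :=
  {x | ∀ (j : ℤ) (n : ℕ), (fun i : Fin n => x (j + (i : ℕ))) ∈ retAdmitted p ks n}

/-- The language `ℒ'` of all non-empty legal words of the return word substitution that do not
contain the letter `∞`. -/
def RetLegal (p : ℕ) (ks : List ℕ) (v : List ℕ) : Prop :=
  v ≠ [] ∧ (∀ k ∈ v, k ∈ retLetters p ks) ∧
    ∃ x ∈ retSubshift p ks, Occurs (v.map fun j : ℕ => (j : OnePoint ℕ)) x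

/-- `v v v` is a subword of `β^{(2)}`, or of `β^{(2)} k β^{(2)}` for some `k ∈ f²(𝒩)` with
`k ≤ k_max`. -/
def CubeInBeta (p : ℕ) (ks : List ℕ) (v : List ℕ) : Prop :=
  v ++ v ++ v <:+: beta p ks 2 ∨
    ∃ k ∈ (affine p ks)^[2] '' retLetters p ks, k ≤ kMax ks ∧
      v ++ v ++ v <:+: beta p ks 2 ++ [k] ++ beta p ks 2

end SubstSchr

/-! Absence of eigenvalues rests on Gordon's three-block argument. If the potential is a cube of
period `q` around a site, the transfer matrix over one period is unimodular, and Cayley–Hamilton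
prevents a solution from being small at all sites one or two periods away unless it is small at the
site itself. Arbitrarily long cubes around one fixed site therefore exclude non-zero `ℓ²` solutions
(`LongCubes.noEigenvalues`).

Such cubes exist almost surely because they have positive frequency at every scale. If `u = c t` and
`u u u c` is legal, then this word lies in the `(m + k)`-th image of every primitive letter.
Applying `ϱ^(n+k)` gives blocks that contain a cube followed by a further copy of `C = ϱ^(n+k)(c)`.
By primitivity `C` carries a fixed fraction of the primitive letters of the block, uniformly in `n`
(`exists_sum_le`). Primitive letters are counted, not all letters, since powers of `a` may dominate
the length. Integration bounds the measure of the cube sets below by a constant times that of `{w |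
w 0 ≠ a}`. Applied to the restriction of `ν` to the invariant set of sequences without long cubes,
the bound shows that this restriction lives on `a^ℤ`, so it vanishes because there are no atoms.
Ergodicity and uniqueness of `ν` are not needed (`ae_longCubes`).

For the two-letter family, legal words are coded by return words `b a^k`, and `ϱ` becomes `k ↦ k_1 ⋯
k_{r-1} f(k)`. The words `β^{(n)}` are prefixes of one Toeplitz sequence `retSeq`. A cube in it
whose period is a multiple of `r` restricts to the multiples of `r` and, as `f` is injective,
descends to a shorter cube; any other period above `r` can be reduced modulo `r` (`cubeFrom_div`,
`cubeFrom_mod`). So some cube has period below `r`. It meets at most one multiple of `r²`, and the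
value there recurs off the multiples of `r`, hence is at most `k_max` (`cubeFrom_cases`). Since
small values appear early in the sequence, the search takes place in a single word `β^{(n)}` with
explicit `n`, which yields the algorithm. -/

namespace SubstSchr

/-! ### Gordon's three-block argument -/

section Gordon

/-- Transfer matrices: solutions of a second order recursion are transported by unimodular
matrices that depend only on the potential. -/
theorem exists_transfer (v : ℕ → ℂ) (n : ℕ) :
    ∃ a b c d : ℂ, a * d - b * c = 1 ∧ ∀ (x ψ : ℤ → ℂ) (j : ℤ),
      (∀ i, ψ (i + 1) = x i * ψ i - ψ (i - 1)) → (∀ i : ℕ, i < n → x (j + i) = v i) →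
      ψ (j + n) = a * ψ j + b * ψ (j - 1) ∧ ψ (j + n - 1) = c * ψ j + d * ψ (j - 1) := by
  induction n with
  | zero => exact ⟨1, 0, 0, 1, by ring, fun x ψ j _ _ => by simp⟩
  | succ n ih =>
    obtain ⟨a, b, c, d, hdet, h⟩ := ih
    refine ⟨v n * a - c, v n * b - d, a, b, by linear_combination hdet, fun x ψ j hψ hx => ?_⟩
    obtain ⟨h1, h2⟩ := h x ψ j hψ fun i hi => hx i (by omega)
    have h3 := hψ (j + n)
    rw [hx n (by omega), h1, h2] at h3
    constructor
    · rw [Nat.cast_succ, ← add_assoc, h3]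
      ring
    · rw [Nat.cast_succ, ← add_assoc, add_sub_cancel_right, h1]

/-- If the potential is a cube around `j`, then a solution cannot be small at all the
neighbouring blocks. -/
theorem norm_le_of_cube {x ψ : ℤ → ℂ} {j : ℤ} {q : ℕ} {ε : ℝ}
    (hψ : ∀ i, ψ (i + 1) = x i * ψ i - ψ (i - 1))
    (hx : ∀ m : ℤ, -q ≤ m → m < q → x (j + m) = x (j + m + q))
    (hε : ∀ m : ℤ, (q : ℤ) - 1 ≤ |m| → ‖ψ (j + m)‖ ≤ ε) (hq : 0 < q) :
    ‖ψ j‖ ≤ 2 * ε ∧ ‖ψ (j - 1)‖ ≤ 2 * ε := by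
  obtain ⟨a, b, c, d, hdet, h⟩ := exists_transfer (fun i => x (j + i)) q
  obtain ⟨h1, h2⟩ := h x ψ j hψ fun i _ => rfl
  obtain ⟨h3, h4⟩ := h x ψ (j + q) hψ fun i hi => by
    rw [hx i (by omega) (by omega)]; congr 1; ring
  obtain ⟨h5, h6⟩ := h x ψ (j - q) hψ fun i hi => by
    have := hx (i - q) (by omega) (by omega)
    convert this using 2 <;> ring
  rw [sub_add_cancel] at h5 h6
  -- With `T` the matrix with rows `(a, b)` and `(c, d)`, `e1` and `e2` express `T⁻¹`. Then `f1`,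
  -- `f2` are `T + T⁻¹ = tr T`, and `g1`, `g2` are `1 = (tr T) T - T²`.
  have e1 : ψ (j - q) = d * ψ j - b * ψ (j - 1) := by
    rw [h5, h6]; linear_combination (-ψ (j - q)) * hdet
  have e2 : ψ (j - q - 1) = a * ψ (j - 1) - c * ψ j := by
    rw [h5, h6]; linear_combination (-ψ (j - q - 1)) * hdet
  have f1 : ψ (j + q) + ψ (j - q) = (a + d) * ψ j := by rw [h1, e1]; ring
  have f2 : ψ (j + q - 1) + ψ (j - q - 1) = (a + d) * ψ (j - 1) := by rw [h2, e2]; ring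
  have g1 : ψ j = (a + d) * ψ (j + q) - ψ (j + q + q) := by
    rw [h3, h2, h1]; linear_combination (-ψ j) * hdet
  have g2 : ψ (j - 1) = (a + d) * ψ (j + q - 1) - ψ (j + q + q - 1) := by
    rw [h4, h1, h2]; linear_combination (-ψ (j - 1)) * hdet
  have b1 : ‖ψ (j + q)‖ ≤ ε := hε q (by rw [abs_of_nonneg] <;> omega)
  have b2 : ‖ψ (j - q)‖ ≤ ε := hε (-q) (by rw [abs_of_nonpos] <;> omega)
  have b3 : ‖ψ (j + q + q)‖ ≤ ε := by
    rw [add_assoc]; exact hε (q + q) (by rw [abs_of_nonneg] <;> omega)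
  -- This is the site nearest to `j` that enters, hence the bound `q - 1` in the hypothesis.
  have b4 : ‖ψ (j + q - 1)‖ ≤ ε := by
    rw [add_sub_assoc]; exact hε (q - 1) (by rw [abs_of_nonneg (by omega)])
  have b5 : ‖ψ (j - q - 1)‖ ≤ ε := by
    have := hε (-q - 1) (by rw [abs_of_nonpos] <;> omega)
    convert this using 3; ring
  have b6 : ‖ψ (j + q + q - 1)‖ ≤ ε := by
    have := hε (q + q - 1) (by rw [abs_of_nonneg] <;> omega)
    convert this using 3; ring
  -- A trace of modulus at least `1` may be divided out of `f1`, `f2`; otherwise `g1`, `g2` bound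
  -- the solution directly.
  rcases le_total 1 ‖a + d‖ with ht | ht
  · have key : ∀ y z₁ z₂ : ℂ, z₁ + z₂ = (a + d) * y → ‖z₁‖ ≤ ε → ‖z₂‖ ≤ ε → ‖y‖ ≤ 2 * ε := by
      intro y z₁ z₂ hy hz₁ hz₂
      have h7 := norm_add_le z₁ z₂
      rw [hy, norm_mul] at h7
      nlinarith [norm_nonneg y]
    exact ⟨key _ _ _ f1 b1 b2, key _ _ _ f2 b4 b5⟩
  · have key : ∀ y z₁ z₂ : ℂ, y = (a + d) * z₁ - z₂ → ‖z₁‖ ≤ ε → ‖z₂‖ ≤ ε → ‖y‖ ≤ 2 * ε := by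
      intro y z₁ z₂ hy hz₁ hz₂
      have h7 := norm_sub_le ((a + d) * z₁) z₂
      rw [← hy, norm_mul] at h7
      nlinarith [norm_nonneg z₁]
    exact ⟨key _ _ _ g1 b1 b3, key _ _ _ g2 b4 b6⟩

variable {𝒜 : Type*}

/-- The sequence `w` has arbitrarily long cubes around some position. -/
def LongCubes (w : ℤ → 𝒜) : Prop :=
  ∃ j : ℤ, ∀ N : ℕ, ∃ q : ℕ, N ≤ q ∧ ∀ m : ℤ, -q ≤ m → m < q → w (j + m) = w (j + m + q)

/-- An `ℓ²` eigenvector decays, so the cube estimate with longer and longer periods forces two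
consecutive values to vanish; the recursion then propagates zero in both directions. -/
theorem LongCubes.noEigenvalues [Finite 𝒜] {w : ℤ → 𝒜} (hw : LongCubes w) (V : 𝒜 → ℝ) :
    NoEigenvalues V w := by
  intro E hE
  obtain ⟨ψ, hψ⟩ := hE.exists_hasEigenvector
  have hne := hψ.2
  have hrec : ∀ i, ψ (i + 1) = (E - V (w i)) * ψ i - ψ (i - 1) := by
    intro i
    have h1 := congrArg (fun φ : Ell2 => φ i) hψ.apply_eq_smul
    have h2 : ψ (i - 1) + ψ (i + 1) + (V (w i) : ℂ) * ψ i = E * ψ i := h1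
    linear_combination h2
  obtain ⟨j, hj⟩ := hw
  have hsmall : ∀ ε > 0, ∃ N : ℕ, ∀ m : ℤ, (N : ℤ) ≤ |m| → ‖ψ (j + m)‖ ≤ ε := by
    intro ε hε
    have h2 : 0 < (2 : ENNReal).toReal := by norm_num
    have hs := (memℓp_gen_iff h2).1 (lp.memℓp ψ)
    have ht := hs.tendsto_cofinite_zero.eventually (gt_mem_nhds (show 0 < ε ^ 2 by positivity))
    have hf : {n : ℤ | ¬ ‖ψ n‖ ^ (2 : ENNReal).toReal < ε ^ 2}.Finite := ht
    obtain ⟨M, hM⟩ := (hf.image fun n => |n - j|).bddAbove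
    refine ⟨(M + 1).toNat, fun m hm => ?_⟩
    by_contra hlt
    have : |m| ≤ M := by
      refine hM ⟨j + m, ?_, by simp⟩
      simp only [Set.mem_ofPred_eq, not_lt, ENNReal.toReal_ofNat, Real.rpow_ofNat]
      exact pow_le_pow_left₀ hε.le (not_le.1 hlt).le 2
    omega
  have hbound : ∀ ε > 0, ‖ψ j‖ ≤ 2 * ε ∧ ‖ψ (j - 1)‖ ≤ 2 * ε := by
    intro ε hε
    obtain ⟨N, hN⟩ := hsmall ε hε
    -- The extra `1` gives `N ≤ q - 1` and makes the period positive.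
    obtain ⟨q, hq, hcube⟩ := hj (N + 1)
    exact norm_le_of_cube (x := fun i => E - V (w i)) (q := q) hrec
      (fun m h1 h2 => by simp only [hcube m h1 h2]) (fun m hm => hN m (by omega)) (by omega)
  have h0 : ψ j = 0 := norm_le_zero_iff.1 <| le_of_forall_pos_le_add fun ε hε => by
    have := (hbound (ε / 2) (by positivity)).1
    linarith
  have h1 : ψ (j - 1) = 0 := norm_le_zero_iff.1 <| le_of_forall_pos_le_add fun ε hε => by
    have := (hbound (ε / 2) (by positivity)).2
    linarith
  have hup : ∀ n : ℕ, ψ (j + n) = 0 ∧ ψ (j + n - 1) = 0 := by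
    intro n
    induction n with
    | zero => simpa using ⟨h0, h1⟩
    | succ n ih =>
      rw [Nat.cast_succ, ← add_assoc, add_sub_cancel_right, hrec, ih.1, ih.2]
      simp
  have hdown : ∀ n : ℕ, ψ (j - n) = 0 ∧ ψ (j - n - 1) = 0 := by
    intro n
    induction n with
    | zero => simpa using ⟨h0, h1⟩
    | succ n ih =>
      have := hrec (j - n - 1)
      rw [sub_add_cancel, ih.1, ih.2] at this
      rw [Nat.cast_succ, ← sub_sub]
      exact ⟨ih.2, by simpa using this⟩
  refine hne (lp.ext (funext fun i => ?_))
  rcases le_total j i with h | h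
  · have := (hup (i - j).toNat).1
    rwa [Int.toNat_of_nonneg (by omega), add_sub_cancel] at this
  · have := (hdown (j - i).toNat).1
    rwa [Int.toNat_of_nonneg (by omega), sub_sub_cancel] at this

end Gordon

section Words

variable {𝒜 : Type*}

/-! ### Iterated substitutions -/

theorem substIter_zero (ϱ : 𝒜 → List 𝒜) (u : List 𝒜) : substIter ϱ 0 u = u := rfl

theorem substIter_succ (ϱ : 𝒜 → List 𝒜) (n : ℕ) (u : List 𝒜) :
    substIter ϱ (n + 1) u = substIter ϱ n (u.flatMap ϱ) := rfl

theorem substIter_succ' (ϱ : 𝒜 → List 𝒜) (n : ℕ) (u : List 𝒜) :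
    substIter ϱ (n + 1) u = (substIter ϱ n u).flatMap ϱ :=
  Function.iterate_succ_apply' _ _ _

theorem substIter_add (ϱ : 𝒜 → List 𝒜) (m n : ℕ) (u : List 𝒜) :
    substIter ϱ (m + n) u = substIter ϱ m (substIter ϱ n u) :=
  Function.iterate_add_apply _ _ _ _

theorem substIter_append (ϱ : 𝒜 → List 𝒜) (n : ℕ) (u v : List 𝒜) :
    substIter ϱ n (u ++ v) = substIter ϱ n u ++ substIter ϱ n v := by
  induction n generalizing u v with
  | zero => rfl
  | succ n ih => simp [substIter_succ, ih]

theorem substIter_nil (ϱ : 𝒜 → List 𝒜) (n : ℕ) : substIter ϱ n [] = [] := by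
  induction n with
  | zero => rfl
  | succ n ih => simpa [substIter_succ] using ih

theorem substIter_eq_flatMap (ϱ : 𝒜 → List 𝒜) (n : ℕ) (u : List 𝒜) :
    substIter ϱ n u = u.flatMap fun c => substIter ϱ n [c] := by
  induction u with
  | nil => simp [substIter_nil]
  | cons c u ih => rw [← List.singleton_append, substIter_append, ih]; simp

theorem _root_.List.IsInfix.substIter (ϱ : 𝒜 → List 𝒜) (n : ℕ) {u v : List 𝒜} (h : u <:+: v) :
    SubstSchr.substIter ϱ n u <:+: SubstSchr.substIter ϱ n v := by
  obtain ⟨s, t, rfl⟩ := h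
  exact ⟨_, _, by rw [substIter_append, substIter_append]⟩

theorem length_substIter_le {ϱ : 𝒜 → List 𝒜} {L : ℕ} (hL : ∀ c, (ϱ c).length ≤ L) (n : ℕ)
    (u : List 𝒜) : (substIter ϱ n u).length ≤ L ^ n * u.length := by
  have hflat : ∀ v : List 𝒜, (v.flatMap ϱ).length ≤ L * v.length := by
    intro v
    induction v with
    | nil => simp
    | cons c v ih =>
      simp only [List.flatMap_cons, List.length_append, List.length_cons]
      nlinarith [hL c]
  induction n with
  | zero => simp [substIter_zero]
  | succ n ih =>
    rw [substIter_succ']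
    calc _ ≤ L * _ := hflat _
      _ ≤ L * (L ^ n * u.length) := Nat.mul_le_mul_left _ ih
      _ = _ := by ring

theorem length_le_length_substIter {ϱ : 𝒜 → List 𝒜} (hϱ : ∀ c, ϱ c ≠ []) (n : ℕ) (u : List 𝒜) :
    u.length ≤ (substIter ϱ n u).length := by
  have hflat : ∀ v : List 𝒜, v.length ≤ (v.flatMap ϱ).length := by
    intro v
    induction v with
    | nil => simp
    | cons c v ih =>
      have := List.length_pos_iff.2 (hϱ c)
      simp only [List.flatMap_cons, List.length_append, List.length_cons]
      omega
  induction n with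
  | zero => rfl
  | succ n ih => rw [substIter_succ']; exact ih.trans (hflat _)

theorem substIter_replicate {ϱ : 𝒜 → List 𝒜} {a : 𝒜} {p : ℕ} (ha : ϱ a = List.replicate p a)
    (n k : ℕ) : substIter ϱ n (List.replicate k a) = List.replicate (p ^ n * k) a := by
  have hflat : ∀ m, (List.replicate m a).flatMap ϱ = List.replicate (p * m) a := by
    intro m
    induction m with
    | zero => simp
    | succ m ih =>
      rw [List.replicate_succ, List.flatMap_cons, ih, ha, ← List.replicate_add]
      congr 1; ring
  induction n with
  | zero => simp [substIter_zero]
  | succ n ih => rw [substIter_succ', ih, hflat]; congr 1; ring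

/-- A subword of a concatenation of short blocks is, up to short words at both ends, itself a
concatenation of blocks. -/
theorem exists_flatMap_of_infix {g : 𝒜 → List 𝒜} {B : ℕ} (hB : ∀ c, (g c).length ≤ B)
    {x z : List 𝒜} (h : x <:+: z.flatMap g) :
    ∃ s z' t : List 𝒜, x = s ++ z'.flatMap g ++ t ∧ s.length ≤ B ∧ t.length ≤ B := by
  have hpre : ∀ (z y : List 𝒜), y <+: z.flatMap g → ∃ z' t : List 𝒜, y = z'.flatMap g ++ t ∧
      t.length ≤ B := by
    intro z
    induction z with
    | nil => intro y hy; exact ⟨[], [], by simpa using hy, by simp⟩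
    | cons c z ih =>
      intro y hy
      rw [List.flatMap_cons] at hy
      rcases le_total (g c).length y.length with hle | hle
      · obtain ⟨y', rfl⟩ := List.prefix_of_prefix_length_le (List.prefix_append _ _) hy hle
        obtain ⟨z', t, rfl, ht⟩ := ih y' ((List.prefix_append_right_inj _).1 hy)
        exact ⟨c :: z', t, by simp, ht⟩
      · exact ⟨[], y, by simp, hle.trans (hB c)⟩
  induction z generalizing x with
  | nil =>
    have : x = [] := by simpa using h
    exact ⟨[], [], [], by simp [this], by simp, by simp⟩
  | cons c z ih =>
    obtain ⟨l, r, hlr⟩ := h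
    rw [List.flatMap_cons, List.append_assoc] at hlr
    rcases List.append_eq_append_iff.1 hlr with ⟨m, h1, h2⟩ | ⟨m, h1, h2⟩
    · rcases List.append_eq_append_iff.1 h2 with ⟨m', h3, h4⟩ | ⟨m', h3, h4⟩
      · refine ⟨x, [], [], by simp, ?_, by simp⟩
        have := hB c
        rw [h1, h3] at this
        simp only [List.length_append] at this
        omega
      · obtain ⟨z', t, hz, ht⟩ := hpre z m' ⟨r, h4.symm⟩
        refine ⟨m, z', t, by rw [h3, hz, List.append_assoc], ?_, ht⟩
        have := hB c
        rw [h1, List.length_append] at this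
        omega
    · exact ih ⟨m, r, by rw [List.append_assoc, ← h2]⟩

/-! ### Windows of bi-infinite sequences -/

@[simp] theorem length_window (w : ℤ → 𝒜) (j : ℤ) (n : ℕ) : (window w j n).length = n := by
  simp [window]

theorem getElem_window (w : ℤ → 𝒜) (j : ℤ) (n i : ℕ) (h : i < (window w j n).length) :
    (window w j n)[i] = w (j + i) := by simp [window]

theorem window_add (w : ℤ → 𝒜) (j : ℤ) (m n : ℕ) :
    window w j (m + n) = window w j m ++ window w (j + m) n := by
  apply List.ext_getElem
  · simp
  · intro i h1 h2
    rw [List.getElem_append, getElem_window]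
    split_ifs with h
    · rw [getElem_window]
    · rw [getElem_window]
      rw [length_window] at h ⊢
      congr 1
      push_cast [Nat.cast_sub (not_lt.1 h)]
      ring

theorem window_eq_append {w : ℤ → 𝒜} {j : ℤ} {x y : List 𝒜}
    (h : window w j (x ++ y).length = x ++ y) :
    window w j x.length = x ∧ window w (j + x.length) y.length = y := by
  rw [List.length_append, window_add] at h
  exact List.append_inj h (by simp)

theorem Occurs.of_infix {u v : List 𝒜} {w : ℤ → 𝒜} (h : u <:+: v) (hv : Occurs v w) :
    Occurs u w := by
  obtain ⟨s, t, rfl⟩ := h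
  obtain ⟨j, hj⟩ := hv
  exact ⟨_, (window_eq_append (window_eq_append hj).1).2⟩

theorem Legal.of_infix {ϱ : 𝒜 → List 𝒜} {u v : List 𝒜} (h : u <:+: v) (hv : Legal ϱ v) :
    Legal ϱ u := by
  obtain ⟨w, hw, ho⟩ := hv
  exact ⟨w, hw, ho.of_infix h⟩

theorem Legal.admitted {ϱ : 𝒜 → List 𝒜} {v : List 𝒜} (hv : Legal ϱ v) : Admitted ϱ v := by
  obtain ⟨w, hw, j, hj⟩ := hv
  exact hj ▸ hw j v.length

/-- Nested words that grow in both directions converge to a bi-infinite sequence. -/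
theorem exists_nested_limit {W X Y : ℕ → List 𝒜} (hX : ∀ n, X n ≠ []) (hY : ∀ n, Y n ≠ [])
    (hW : ∀ n, W (n + 1) = X n ++ W n ++ Y n) :
    ∃ w : ℤ → 𝒜, (∀ n, Occurs (W n) w) ∧ ∀ j N, ∃ n, window w j N <:+: W n := by
  -- `o n` is the index in `W n` of the letter that is placed at the origin; it has at least `n`
  -- letters before it, and at least `n` from it onwards.
  let o : ℕ → ℕ := fun n => ∑ i ∈ Finset.range n, (X i).length
  have ho : ∀ n, o (n + 1) = o n + (X n).length := fun n => Finset.sum_range_succ _ _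
  have hXl : ∀ n, 0 < (X n).length := fun n => List.length_pos_iff.2 (hX n)
  have hYl : ∀ n, 0 < (Y n).length := fun n => List.length_pos_iff.2 (hY n)
  have hon : ∀ n, n ≤ o n := by
    intro n
    induction n with
    | zero => simp
    | succ n ih => have := ho n; have := hXl n; omega
  have hlen : ∀ n, o n + n ≤ (W n).length := by
    intro n
    induction n with
    | zero => simp [o]
    | succ n ih =>
      have := ho n; have := hYl n
      rw [hW, List.length_append, List.length_append]
      omega
  have hstep : ∀ n i, i < (W n).length → (W (n + 1))[(X n).length + i]? = (W n)[i]? := by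
    intro n i hi
    rw [hW, List.append_assoc, List.getElem?_append_right (by omega), Nat.add_sub_cancel_left,
      List.getElem?_append_left hi]
  have hstable : ∀ (j : ℤ) (n k : ℕ), 0 ≤ o n + j → o n + j < (W n).length →
      (W (n + k))[(o (n + k) + j).toNat]? = (W n)[(o n + j).toNat]? ∧
        0 ≤ o (n + k) + j ∧ o (n + k) + j < (W (n + k)).length := by
    intro j n k h1 h2
    induction k with
    | zero => exact ⟨rfl, h1, h2⟩
    | succ k ih =>
      obtain ⟨h3, h4, h5⟩ := ih
      have h6 := ho (n + k)
      have h7 := congrArg List.length (hW (n + k))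
      rw [List.length_append, List.length_append] at h7
      rw [← add_assoc]
      refine ⟨?_, by omega, by omega⟩
      rw [← h3, ← hstep _ _ (show (o (n + k) + j).toNat < _ by omega)]
      congr 1
      omega
  -- The word with index `|j| + 1` already covers position `j`, and later words do not change the
  -- letter there.
  have hex : ∀ j : ℤ, ∃ c, (W (j.natAbs + 1))[(o (j.natAbs + 1) + j).toNat]? = some c := by
    intro j
    have := hlen (j.natAbs + 1); have := hon (j.natAbs + 1)
    exact ⟨_, List.getElem?_eq_getElem (by omega)⟩
  choose w hw using hex
  have hval : ∀ (n : ℕ) (j : ℤ), 0 ≤ o n + j → o n + j < (W n).length →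
      (W n)[(o n + j).toNat]? = some (w j) := by
    intro n j h1 h2
    have := hlen (j.natAbs + 1); have := hon (j.natAbs + 1)
    rw [← (hstable j n (j.natAbs + 1) h1 h2).1, ← hw j,
      ← (hstable j (j.natAbs + 1) n (by omega) (by omega)).1, add_comm n]
  have hwin : ∀ (n : ℕ) (j : ℤ) (N : ℕ), 0 ≤ o n + j → o n + j + N ≤ (W n).length →
      window w j N = ((W n).drop (o n + j).toNat).take N := by
    intro n j N h1 h2
    apply List.ext_getElem?
    intro i
    rw [List.getElem?_take, List.getElem?_drop]
    split_ifs with hi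
    · rw [List.getElem?_eq_getElem (by simpa using hi), getElem_window,
        ← hval n (j + i) (by omega) (by omega)]
      congr 1
      omega
    · exact List.getElem?_eq_none (by simpa using hi)
  refine ⟨w, fun n => ⟨-o n, ?_⟩, fun j N => ⟨j.natAbs + N + 1, ?_⟩⟩
  · rw [hwin n _ _ (by omega) (by omega)]
    simp
  · have := hlen (j.natAbs + N + 1); have := hon (j.natAbs + N + 1)
    rw [hwin (j.natAbs + N + 1) j N (by omega) (by omega)]
    exact (List.take_prefix _ _).isInfix.trans (List.drop_suffix _ _).isInfix

end Words

/-! ### Absence of eigenvalues almost everywhere -/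

section Frequencies

open scoped ENNReal

variable {𝒜 : Type*}

open Classical in
/-- The indicator function of the primitive letters. -/
noncomputable def primWeight (a c : 𝒜) : ℝ≥0∞ := if c = a then 0 else 1

/-- The number of occurrences of primitive letters in a word. -/
noncomputable def primCount (a : 𝒜) (l : List 𝒜) : ℝ≥0∞ := (l.map (primWeight a)).sum

/-- Sequences with a primitive letter at the origin around which there is a cube of period `q`. -/
def cubeSet (a : 𝒜) (q : ℕ) : Set (ℤ → 𝒜) :=
  {w | w 0 ≠ a ∧ ∀ m : ℤ, -q ≤ m → m < q → w m = w (m + q)}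

/-- The indicator function of those positions at which `w` has a cube of period `q`. -/
noncomputable def cubeAt (a : 𝒜) (q : ℕ) (w : ℤ → 𝒜) (i : ℤ) : ℝ≥0∞ :=
  (cubeSet a q).indicator 1 fun k => w (i + k)

@[simp] theorem primWeight_self (a : 𝒜) : primWeight a a = 0 := by simp [primWeight]

theorem primWeight_of_ne {a c : 𝒜} (h : c ≠ a) : primWeight a c = 1 := by simp [primWeight, h]

@[simp] theorem primCount_nil (a : 𝒜) : primCount a [] = 0 := by simp [primCount]

theorem primCount_append (a : 𝒜) (u v : List 𝒜) :
    primCount a (u ++ v) = primCount a u + primCount a v := by simp [primCount]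

theorem primCount_le_of_infix (a : 𝒜) {u v : List 𝒜} (h : u <:+: v) :
    primCount a u ≤ primCount a v := by
  obtain ⟨s, t, rfl⟩ := h
  rw [primCount_append, primCount_append]
  exact le_add_right le_add_self

theorem primCount_replicate (a : 𝒜) (n : ℕ) : primCount a (List.replicate n a) = 0 := by
  simp [primCount]

theorem primCount_flatMap_le {a : 𝒜} {g : 𝒜 → List 𝒜} {b : ℝ≥0∞}
    (h : ∀ c, primCount a (g c) ≤ b) (l : List 𝒜) :
    primCount a (l.flatMap g) ≤ l.length * b := by
  induction l with
  | nil => simp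
  | cons c l ih =>
    rw [List.flatMap_cons, primCount_append, List.length_cons, Nat.cast_succ, add_mul, one_mul,
      add_comm]
    exact add_le_add ih (h c)

theorem primCount_window (a : 𝒜) (w : ℤ → 𝒜) (j : ℤ) (n : ℕ) :
    primCount a (window w j n) = ∑ i ∈ Finset.range n, primWeight a (w (j + i)) := by
  rw [primCount, window, List.map_ofFn, List.sum_ofFn]
  exact Fin.sum_univ_eq_sum_range (fun i => primWeight a (w (j + i))) n

/-- Each leading position of the last block of a cube that is continued by one prefix sees a
cube. -/
theorem primCount_le_sum_cubeAt {a : 𝒜} {w : ℤ → 𝒜} {j : ℤ} {P C T S : List 𝒜}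
    (h : window w j (P ++ ((C ++ T) ++ (C ++ T) ++ (C ++ T) ++ C) ++ S).length =
      P ++ ((C ++ T) ++ (C ++ T) ++ (C ++ T) ++ C) ++ S) :
    primCount a C ≤ ∑ i ∈ Finset.range
      (P ++ ((C ++ T) ++ (C ++ T) ++ (C ++ T) ++ C) ++ S).length,
        cubeAt a (C ++ T).length w (j + i) := by
  set U := C ++ T with hU
  set q := U.length with hq
  have hZ := (window_eq_append (window_eq_append h).1).2
  have hR : window w (j + P.length) (U ++ U ++ C).length = U ++ U ++ C := by
    have e : U ++ U ++ U ++ C = (U ++ U ++ C) ++ (T ++ C) := by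
      rw [hU]; simp only [List.append_assoc]
    rw [e] at hZ
    exact (window_eq_append hZ).1
  have hR' : window w (j + P.length + q) (U ++ U ++ C).length = U ++ U ++ C := by
    have e : U ++ U ++ U ++ C = U ++ (U ++ U ++ C) := by simp only [List.append_assoc]
    rw [e] at hZ
    exact (window_eq_append hZ).2
  have hC : window w (j + P.length + q) C.length = C := by
    rw [hU, List.append_assoc, List.append_assoc] at hR'
    exact (window_eq_append hR').1
  have hper : ∀ t : ℕ, t < 2 * q + C.length →
      w (j + P.length + t) = w (j + P.length + t + q) := by
    intro t ht
    have hlen : (U ++ U ++ C).length = 2 * q + C.length := by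
      simp only [List.length_append]; omega
    have h1 := getElem_window w (j + P.length) (U ++ U ++ C).length t (by rw [length_window, hlen]; exact ht)
    have h2 := getElem_window w (j + P.length + q) (U ++ U ++ C).length t (by rw [length_window, hlen]; exact ht)
    rw [← h1, show j + P.length + t + q = j + P.length + q + t by ring, ← h2]
    simp only [hR, hR']
  -- The second copy of `C` is used: relative to the start of `U U U C`, its position `q + i`
  -- requires periodicity exactly on the stretch from `i` to `i + 3q - 1`, which fits because `i <
  -- |C|`.
  have hterm : ∀ i ∈ Finset.range C.length, primWeight a (w (j + P.length + q + i)) ≤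
      cubeAt a q w (j + P.length + q + i) := by
    intro i hi
    rw [Finset.mem_range] at hi
    by_cases hw : w (j + P.length + q + i) = a
    · simp [hw]
    · rw [primWeight_of_ne hw, cubeAt, Set.indicator_of_mem]
      · rfl
      · refine ⟨by simpa using hw, fun m h1 h2 => ?_⟩
        have := hper (q + i + m).toNat (by omega)
        convert this using 2 <;> omega
  nth_rewrite 1 [← hC]
  rw [primCount_window]
  refine (Finset.sum_le_sum hterm).trans ?_
  have e : (P ++ (U ++ U ++ U ++ C) ++ S).length =
      (P.length + q) + (C.length + (2 * q + S.length)) := by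
    simp only [List.length_append]; omega
  rw [e, Finset.sum_range_add _ (P.length + q), Finset.sum_range_add _ C.length]
  refine le_trans (le_of_eq (Finset.sum_congr rfl fun i _ => ?_)) (le_add_left (le_add_right le_rfl))
  congr 1
  push_cast
  ring

theorem primCount_flatMap_le_sum {a : 𝒜} {f : ℤ → ℝ≥0∞} {g : 𝒜 → List 𝒜} {D : ℝ≥0∞} {w : ℤ → 𝒜}
    (hg : ∀ (c : 𝒜) (j : ℤ), window w j (g c).length = g c →
      primCount a (g c) ≤ D * ∑ i ∈ Finset.range (g c).length, f (j + i))
    (z : List 𝒜) (j : ℤ) (h : window w j (z.flatMap g).length = z.flatMap g) :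
    primCount a (z.flatMap g) ≤ D * ∑ i ∈ Finset.range (z.flatMap g).length, f (j + i) := by
  induction z generalizing j with
  | nil => simp
  | cons c z ih =>
    rw [List.flatMap_cons] at h ⊢
    obtain ⟨h1, h2⟩ := window_eq_append h
    rw [primCount_append, List.length_append, Finset.sum_range_add, mul_add]
    refine add_le_add (hg c j h1) ((ih _ h2).trans (le_of_eq ?_))
    simp only [Nat.cast_add, add_assoc]

/-- Incomplete blocks at the two ends of a window of length `4 * B` take up at most `B` letters
each, so the middle `2 * B` letters lie in complete blocks, where the blockwise bound adds up. -/
theorem sum_primWeight_le {a : 𝒜} {f : ℤ → ℝ≥0∞} {g : 𝒜 → List 𝒜} {D : ℝ≥0∞} {w : ℤ → 𝒜} {B : ℕ}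
    (hg : ∀ (c : 𝒜) (j : ℤ), window w j (g c).length = g c →
      primCount a (g c) ≤ D * ∑ i ∈ Finset.range (g c).length, f (j + i))
    (hB : ∀ c, (g c).length ≤ B) {j : ℤ} {z : List 𝒜} (h : window w j (4 * B) <:+: z.flatMap g) :
    ∑ i ∈ Finset.range (2 * B), primWeight a (w (j + (B + i : ℕ))) ≤
      D * ∑ i ∈ Finset.range (4 * B), f (j + i) := by
  obtain ⟨s, z', t, hx, hs, ht⟩ := exists_flatMap_of_infix hB h
  have hlen := congrArg List.length hx
  simp only [length_window, List.length_append] at hlen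
  have hx' : window w j (s ++ z'.flatMap g ++ t).length = s ++ z'.flatMap g ++ t := by
    rw [← hx, length_window]
  have hmid := (window_eq_append (window_eq_append hx').1).2
  have key := primCount_flatMap_le_sum hg z' _ hmid
  obtain ⟨e, he⟩ := Nat.exists_eq_add_of_le hs
  obtain ⟨e', he'⟩ := Nat.exists_eq_add_of_le (show e + 2 * B ≤ (z'.flatMap g).length by omega)
  calc ∑ i ∈ Finset.range (2 * B), primWeight a (w (j + (B + i : ℕ)))
      ≤ primCount a (z'.flatMap g) := by
        rw [← hmid, primCount_window, he', Finset.sum_range_add,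
          Finset.sum_range_add]
        refine le_trans (le_of_eq (Finset.sum_congr rfl fun i _ => ?_))
          (le_add_right le_add_self)
        congr 2
        rw [he]
        push_cast
        ring
    _ ≤ _ := key
    _ ≤ _ := by
        gcongr
        rw [show 4 * B = s.length + ((z'.flatMap g).length + t.length) by omega,
          Finset.sum_range_add, Finset.sum_range_add]
        refine le_trans (le_of_eq (Finset.sum_congr rfl fun i _ => ?_))
          (le_add_left (le_add_right le_rfl))
        congr 1
        push_cast
        ring

theorem iterate_shift (n : ℕ) (w : ℤ → 𝒜) : shift^[n] w = fun k => w (n + k) := by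
  induction n with
  | zero => simp
  | succ n ih =>
    rw [Function.iterate_succ_apply', ih]
    funext k
    simp only [shift]
    congr 1
    push_cast
    ring

theorem longCubes_shift (w : ℤ → 𝒜) : LongCubes (shift w) ↔ LongCubes w := by
  constructor
  · rintro ⟨j, hj⟩
    refine ⟨j + 1, fun N => ?_⟩
    obtain ⟨q, hq, h⟩ := hj N
    refine ⟨q, hq, fun m h1 h2 => ?_⟩
    have := h m h1 h2
    simp only [shift] at this
    convert this using 2 <;> ring
  · rintro ⟨j, hj⟩
    refine ⟨j - 1, fun N => ?_⟩
    obtain ⟨q, hq, h⟩ := hj N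
    refine ⟨q, hq, fun m h1 h2 => ?_⟩
    have := h m h1 h2
    simp only [shift]
    convert this using 2 <;> ring

variable [Finite 𝒜] [MeasurableSpace 𝒜] [DiscreteMeasurableSpace 𝒜]

theorem measurableSet_cubeSet (a : 𝒜) (q : ℕ) : MeasurableSet (cubeSet a q) := by
  have : cubeSet a q = {w | w 0 = a}ᶜ ∩ ⋂ m : ℤ, ⋂ _ : -q ≤ m, ⋂ _ : m < q,
      {w | w m = w (m + q)} := by
    ext w; simp [cubeSet]
  rw [this]
  refine MeasurableSet.inter (measurableSet_eq_fun (measurable_pi_apply 0)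
    measurable_const).compl ?_
  exact MeasurableSet.iInter fun m => MeasurableSet.iInter fun _ => MeasurableSet.iInter fun _ =>
    measurableSet_eq_fun (measurable_pi_apply m) (measurable_pi_apply _)

theorem measurableSet_longCubes : MeasurableSet {w : ℤ → 𝒜 | LongCubes w} := by
  have : {w : ℤ → 𝒜 | LongCubes w} = ⋃ j : ℤ, ⋂ N : ℕ, ⋃ q : ℕ, ⋃ _ : N ≤ q, ⋂ m : ℤ,
      ⋂ _ : -q ≤ m, ⋂ _ : m < q, {w | w (j + m) = w (j + m + q)} := by
    ext w; simp [LongCubes]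
  rw [this]
  exact MeasurableSet.iUnion fun j => MeasurableSet.iInter fun N => MeasurableSet.iUnion fun q =>
    MeasurableSet.iUnion fun _ => MeasurableSet.iInter fun m => MeasurableSet.iInter fun _ =>
    MeasurableSet.iInter fun _ =>
    measurableSet_eq_fun (measurable_pi_apply _) (measurable_pi_apply _)

theorem measurableSet_origin_ne (a : 𝒜) : MeasurableSet {w : ℤ → 𝒜 | w 0 ≠ a} :=
  (measurableSet_eq_fun (measurable_pi_apply 0) measurable_const).compl

/-- A local inequality between the numbers of primitive letters and of cubes yields the same
inequality for the measures. -/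
theorem measure_le_of_sum_le {μ : Measure (ℤ → 𝒜)} (hμ : MeasurePreserving shift μ μ) {a : 𝒜}
    {q B : ℕ} {D : ℝ≥0∞} (hB : 0 < B)
    (h : ∀ᵐ w ∂μ, ∑ i ∈ Finset.range (2 * B), primWeight a (w (0 + (B + i : ℕ))) ≤
      D * ∑ i ∈ Finset.range (4 * B), cubeAt a q w (0 + i)) :
    μ {w | w 0 ≠ a} ≤ 2 * D * μ (cubeSet a q) := by
  have hind : ∀ (s : Set (ℤ → 𝒜)) (_ : MeasurableSet s) (n : ℕ),
      ∫⁻ w, s.indicator 1 (fun k => w (n + k)) ∂μ = μ s := by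
    intro s hs n
    have h1 := (hμ.iterate n).lintegral_comp ((measurable_one (α := ℝ≥0∞)).indicator hs)
    rw [lintegral_indicator_one hs] at h1
    simpa only [iterate_shift] using h1
  have hmeas : ∀ (s : Set (ℤ → 𝒜)) (_ : MeasurableSet s) (n : ℕ),
      Measurable fun w : ℤ → 𝒜 => s.indicator (1 : (ℤ → 𝒜) → ℝ≥0∞) (fun k => w (n + k)) := by
    intro s hs n
    have := ((measurable_one (α := ℝ≥0∞)).indicator hs).comp (hμ.iterate n).measurable
    simpa only [Function.comp_def, iterate_shift] using this
  have hw : ∀ (w : ℤ → 𝒜) (n : ℕ), primWeight a (w (0 + n)) =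
      {w : ℤ → 𝒜 | w 0 ≠ a}.indicator 1 (fun k => w (n + k)) := by
    intro w n
    by_cases hn : w n = a <;> simp [primWeight, Set.indicator, hn]
  simp only [hw] at h
  simp only [cubeAt, zero_add] at h
  -- By invariance all summands on one side have the same integral, so this becomes `2B μ{w 0 ≠ a} ≤
  -- D · 4B μ(cubeSet)`.
  have h2 := lintegral_mono_ae h
  rw [lintegral_finsetSum _ fun i _ => hmeas _ (measurableSet_origin_ne a) _,
    lintegral_const_mul _ (Finset.measurable_sum _ fun i _ => hmeas _ (measurableSet_cubeSet a q) i),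
    lintegral_finsetSum _ fun i _ => hmeas _ (measurableSet_cubeSet a q) _] at h2
  simp only [hind _ (measurableSet_origin_ne a), hind _ (measurableSet_cubeSet a q),
    Finset.sum_const, Finset.card_range, nsmul_eq_mul] at h2
  have hB0 : ((2 * B : ℕ) : ℝ≥0∞) ≠ 0 := by exact_mod_cast (by omega : 2 * B ≠ 0)
  refine (ENNReal.mul_le_mul_iff_right hB0 (ENNReal.natCast_ne_top _)).1 (h2.trans (le_of_eq ?_))
  push_cast
  ring

/-- If cubes of arbitrarily long periods have positive frequency, bounded from below, among the
primitive positions with respect to a measure, then it gives positive mass to sequences with long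
cubes, unless it is carried by `a^ℤ`. -/
theorem measure_origin_ne_eq_zero {μ : Measure (ℤ → 𝒜)} {a : 𝒜} {D : ℝ≥0∞} (hD : D ≠ ⊤)
    (hfin : μ {w | w 0 ≠ a} ≠ ⊤)
    (h : ∀ N : ℕ, ∃ q, N ≤ q ∧ μ {w | w 0 ≠ a} ≤ D * μ (cubeSet a q))
    (h0 : μ {w | LongCubes w} = 0) : μ {w | w 0 ≠ a} = 0 := by
  choose q hq hle using h
  let E : ℕ → Set (ℤ → 𝒜) := fun m => ⋃ t : ℕ, ⋃ _ : m ≤ t, cubeSet a (q t)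
  have hE : ∀ m, MeasurableSet (E m) := fun m =>
    MeasurableSet.iUnion fun t => MeasurableSet.iUnion fun _ => measurableSet_cubeSet a _
  have hanti : Antitone E := fun m n hmn => Set.iUnion_mono fun t =>
    Set.iUnion_subset fun ht => Set.subset_iUnion_of_subset (hmn.trans ht) subset_rfl
  -- Continuity from above needs finite measure, although `μ` itself may be infinite; it holds since
  -- cube sets demand a primitive letter at the origin.
  have hEfin : μ (E 0) ≠ ⊤ := by
    refine ne_top_of_le_ne_top hfin (measure_mono ?_)
    exact Set.iUnion_subset fun t => Set.iUnion_subset fun _ => fun w hw => hw.1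
  have hlim := tendsto_measure_iInter_atTop (fun m => (hE m).nullMeasurableSet) hanti ⟨0, hEfin⟩
  -- A point of the intersection has cubes of unbounded period, all around the origin, so it has
  -- long cubes.
  have hnull : μ (⋂ m, E m) = 0 := by
    refine measure_mono_null (fun w hw => ?_) h0
    refine ⟨0, fun N => ?_⟩
    obtain ⟨t, ht⟩ := Set.mem_iUnion.1 (Set.mem_iInter.1 hw N)
    obtain ⟨htN, hw'⟩ := Set.mem_iUnion.1 ht
    exact ⟨q t, htN.trans (hq t), fun m h1 h2 => by simpa using hw'.2 m h1 h2⟩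
  rw [hnull] at hlim
  have hlim' := ENNReal.Tendsto.const_mul (a := D) hlim (Or.inr hD)
  rw [mul_zero] at hlim'
  have hsub : ∀ m, cubeSet a (q m) ⊆ E m := fun m w hw =>
    Set.mem_iUnion.2 ⟨m, Set.mem_iUnion.2 ⟨le_rfl, hw⟩⟩
  exact le_antisymm (ge_of_tendsto' hlim' fun m => (hle m).trans
    (mul_le_mul_right (measure_mono (hsub m)) D)) zero_le

/-- The reduction of the theorem on eigenvalues to a lower bound for the frequency of cubes. -/
theorem ae_longCubes [TopologicalSpace 𝒜] [DiscreteTopology 𝒜] {ϱ : 𝒜 → List 𝒜} {a : 𝒜} {ν : Measure (ℤ → 𝒜)}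
    (hν : IsNonatomicInvariant ϱ a ν) {D : ℝ≥0∞} (hD : D ≠ ⊤)
    (h : ∀ N : ℕ, ∃ q B, N ≤ q ∧ 0 < B ∧ ∀ w ∈ subshift ϱ,
      ∑ i ∈ Finset.range (2 * B), primWeight a (w (0 + (B + i : ℕ))) ≤
      D * ∑ i ∈ Finset.range (4 * B), cubeAt a q w (0 + i)) :
    ∀ᵐ w ∂ν, LongCubes w := by
  set A : Set (ℤ → 𝒜) := {w | LongCubes w} with hA
  have hAm : MeasurableSet A := measurableSet_longCubes
  -- The exceptional set is shift-invariant, so `μ` inherits invariance; the aim is `μ = 0`.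
  set μ := ν.restrict Aᶜ with hμ
  have hpre : shift ⁻¹' Aᶜ = Aᶜ := by
    ext w; simp [hA, longCubes_shift]
  have hinv : MeasurePreserving shift μ μ := by
    have := hν.invariant.restrict_preimage hAm.compl
    rwa [hpre] at this
  have hX : ∀ᵐ w ∂μ, w ∈ subshift ϱ := ae_restrict_of_ae hν.carried
  have hclopen : IsClopen {w : ℤ → 𝒜 | w 0 ≠ a} :=
    (isClopen_discrete {c | c ≠ a}).preimage (continuous_apply 0)
  have hfin : μ {w | w 0 ≠ a} ≠ ⊤ :=
    ne_top_of_le_ne_top (hν.finite_of_clopen _ hclopen (by simp)).ne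
      (Measure.restrict_apply_le _ _)
  have hzero : μ {w | w 0 ≠ a} = 0 := by
    refine measure_origin_ne_eq_zero (D := 2 * D) (ENNReal.mul_ne_top (by simp) hD) hfin ?_ ?_
    · intro N
      obtain ⟨q, B, hq, hB, hle⟩ := h N
      exact ⟨q, hq, measure_le_of_sum_le hinv hB (hX.mono fun w hw => hle w hw)⟩
    · rw [hμ, Measure.restrict_apply hAm, Set.inter_compl_self, measure_empty]
  -- Invariance carries the statement at the origin to every position; negative ones are reached by
  -- pulling back the event at `-n` to the origin.
  have hpos : ∀ n : ℕ, ∀ᵐ w ∂μ, w n = a := by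
    intro n
    have h1 := (hinv.iterate n).measure_preimage (measurableSet_origin_ne a).nullMeasurableSet
    rw [hzero] at h1
    have h2 : ∀ᵐ w ∂μ, ¬ (shift^[n] w) 0 ≠ a :=
      measure_eq_zero_iff_ae_notMem.1 h1
    simpa [iterate_shift] using h2
  have hneg : ∀ n : ℕ, ∀ᵐ w ∂μ, w (-n) = a := by
    intro n
    have hm : MeasurableSet {w : ℤ → 𝒜 | w (-n) ≠ a} :=
      (measurableSet_eq_fun (measurable_pi_apply _) measurable_const).compl
    have h1 := (hinv.iterate n).measure_preimage hm.nullMeasurableSet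
    have h2 : shift^[n] ⁻¹' {w : ℤ → 𝒜 | w (-n) ≠ a} = {w | w 0 ≠ a} := by
      ext w; simp [iterate_shift]
    rw [h2, hzero] at h1
    simpa using show ∀ᵐ w ∂μ, ¬ w (-n) ≠ a from
      measure_eq_zero_iff_ae_notMem.1 h1.symm
  have hall : ∀ᵐ w ∂μ, w = fun _ => a := by
    filter_upwards [ae_all_iff.2 hpos, ae_all_iff.2 hneg] with w h1 h2
    funext i
    obtain ⟨n, rfl | rfl⟩ := i.eq_nat_or_neg
    exacts [h1 n, h2 n]
  have hatom : ∀ᵐ w ∂μ, w ≠ fun _ => a := by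
    refine ae_restrict_of_ae ?_
    rw [ae_iff]
    simpa using hν.nonatomic fun _ => a
  have hF : ∀ᵐ w ∂μ, False := by
    filter_upwards [hall, hatom] with w h1 h2 using h2 h1
  rw [Filter.eventually_false_iff_eq_bot, ae_eq_bot, hμ, Measure.restrict_eq_zero] at hF
  exact hF

end Frequencies

/-! ### Frequency of cubes for almost primitive substitutions -/

section AlmostPrimitive

open scoped ENNReal

variable {𝒜 : Type*} {ϱ : 𝒜 → List 𝒜} {a : 𝒜}

/-- The images of a primitive letter become arbitrarily long. -/
theorem IsAlmostPrimitive.exists_length_le (h : IsAlmostPrimitive ϱ a) {c : 𝒜} (hc : c ≠ a)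
    (k t : ℕ) : ∃ n, t ≤ (substIter ϱ (n + k) [c]).length := by
  obtain ⟨l, hl⟩ := h.primitive
  induction t with
  | zero => exact ⟨0, Nat.zero_le _⟩
  | succ t ih =>
    obtain ⟨n, hn⟩ := ih
    refine ⟨n + l, ?_⟩
    obtain ⟨s, s', hs⟩ := List.append_of_mem (hl c c hc)
    -- Besides `c`, the image also contains `a`, so each further application of `ϱ^l` adds at least
    -- one letter.
    have hss : 0 < (s ++ s').length := by
      rw [List.length_pos_iff]
      intro h0
      have ha := hl a c hc
      rw [List.append_eq_nil_iff] at h0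
      rw [hs, h0.1, h0.2] at ha
      exact hc (List.mem_singleton.1 ha).symm
    rw [show n + l + k = n + k + l by ring, substIter_add, hs, ← List.singleton_append,
      substIter_append, substIter_append, List.length_append, List.length_append]
    have h1 := length_le_length_substIter h.image_ne_nil (n + k) s
    have h2 := length_le_length_substIter h.image_ne_nil (n + k) s'
    rw [List.length_append] at hss
    omega

theorem singleton_infix_of_mem {c : 𝒜} {l : List 𝒜} (h : c ∈ l) : [c] <:+: l := by
  obtain ⟨s, t, rfl⟩ := List.append_of_mem h
  exact ⟨s, t, by simp⟩

/-- Cubes have positive frequency on all scales. -/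
theorem IsAlmostPrimitive.exists_sum_le [Finite 𝒜] (h : IsAlmostPrimitive ϱ a)
    (hcube : HasCubePlus ϱ a) : ∃ D : ℝ≥0∞, D ≠ ⊤ ∧ ∀ N : ℕ, ∃ q B, N ≤ q ∧ 0 < B ∧
      ∀ w ∈ subshift ϱ,
      ∑ i ∈ Finset.range (2 * B), primWeight a (w (0 + (B + i : ℕ))) ≤
      D * ∑ i ∈ Finset.range (4 * B), cubeAt a q w (0 + i) := by
  obtain ⟨c, t, hc, hleg⟩ := hcube
  obtain ⟨d, m, -, hdm⟩ := hleg.admitted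
  obtain ⟨k, hk⟩ := h.primitive
  obtain ⟨p, -, hp⟩ := h.map_a
  obtain ⟨L, hL1, hL⟩ : ∃ L : ℕ, 0 < L ∧ ∀ c, (ϱ c).length ≤ L := by
    obtain ⟨L, hL⟩ := (Set.finite_range fun c => (ϱ c).length).bddAbove
    exact ⟨L + 1, by omega, fun c => (hL ⟨c, rfl⟩).trans (by omega)⟩
  -- The constant is fixed before the scale `n`: it bounds the number of `ϱ^n`-blocks in one block
  -- of level `n + k + (m + k)`.
  refine ⟨(L ^ (k + (m + k)) : ℕ), ENNReal.natCast_ne_top _, fun N => ?_⟩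
  obtain ⟨n, hn⟩ := h.exists_length_le hc k N
  refine ⟨(substIter ϱ (n + k) (c :: t)).length, L ^ (n + k + (m + k)), ?_, by positivity,
    fun w hw => ?_⟩
  · rw [← List.singleton_append, substIter_append, List.length_append]
    omega
  obtain ⟨e, M, -, heM⟩ := hw 0 (4 * L ^ (n + k + (m + k)))
  -- Every letter `y` occurs in `ϱ^k(c)`, so `ϱ^(n+k)(c)` dominates all blocks of level `n`.
  have hcount : ∀ y, primCount a (substIter ϱ n [y]) ≤ primCount a (substIter ϱ (n + k) [c]) := by
    intro y
    rw [substIter_add]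
    exact primCount_le_of_infix a ((singleton_infix_of_mem (hk y c hc)).substIter ϱ n)
  -- A window of length `4B` does not fit into an image of lower level, so the window can be cut
  -- into blocks of the chosen level.
  have hMle : n + k + (m + k) ≤ M := by
    by_contra hlt
    have h1 := heM.length_le
    have h2 := length_substIter_le hL M [e]
    rw [length_window] at h1
    have h3 : L ^ M ≤ L ^ (n + k + (m + k)) := Nat.pow_le_pow_right hL1 (by omega)
    have h4 : 0 < L ^ (n + k + (m + k)) := by positivity
    simp only [List.length_singleton, mul_one] at h2
    omega
  obtain ⟨M', rfl⟩ := Nat.exists_eq_add_of_le hMle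
  rw [substIter_add, substIter_eq_flatMap] at heM
  -- Blocks from the letter `a` contain no primitive letters, so only those from `y ≠ a` need cubes.
  refine sum_primWeight_le (fun y j hy => ?_) (fun y => ?_) heM
  · by_cases hya : y = a
    · have := substIter_replicate hp (n + k + (m + k)) 1
      rw [List.replicate_one] at this
      rw [hya, this, primCount_replicate]
      exact zero_le
    · have hin : (c :: t) ++ (c :: t) ++ (c :: t) ++ [c] <:+: substIter ϱ (m + k) [y] := by
        rw [substIter_add]
        exact hdm.trans ((singleton_infix_of_mem (hk d y hya)).substIter ϱ m)
      obtain ⟨P, S, hPS⟩ := hin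
      have hy2 : substIter ϱ (n + k + (m + k)) [y] = substIter ϱ (n + k) P ++
          ((substIter ϱ (n + k) [c] ++ substIter ϱ (n + k) t) ++
          (substIter ϱ (n + k) [c] ++ substIter ϱ (n + k) t) ++
          (substIter ϱ (n + k) [c] ++ substIter ϱ (n + k) t) ++ substIter ϱ (n + k) [c]) ++
          substIter ϱ (n + k) S := by
        rw [substIter_add, ← hPS, ← List.singleton_append (x := c) (l := t)]
        simp only [substIter_append]
      have hle : primCount a (substIter ϱ (n + k + (m + k)) [y]) ≤
          (L ^ (k + (m + k)) : ℕ) * primCount a (substIter ϱ (n + k) [c]) := by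
        rw [add_assoc, substIter_add ϱ n, substIter_eq_flatMap ϱ n]
        refine (primCount_flatMap_le hcount _).trans ?_
        gcongr
        simpa using length_substIter_le hL (k + (m + k)) [y]
      refine hle.trans (mul_le_mul_right ?_ _)
      rw [hy2] at hy ⊢
      refine (primCount_le_sum_cubeAt hy).trans (le_of_eq ?_)
      rw [← substIter_append, List.singleton_append]
  · simpa using length_substIter_le hL (n + k + (m + k)) [y]

theorem IsAlmostPrimitive.ae_noEigenvalues [Finite 𝒜] [TopologicalSpace 𝒜] [DiscreteTopology 𝒜]
    [MeasurableSpace 𝒜] [DiscreteMeasurableSpace 𝒜] (h : IsAlmostPrimitive ϱ a)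
    (hcube : HasCubePlus ϱ a) (V : 𝒜 → ℝ) {ν : Measure (ℤ → 𝒜)}
    (hν : IsNonatomicInvariant ϱ a ν) : ∀ᵐ w ∂ν, NoEigenvalues V w := by
  obtain ⟨D, hD, hle⟩ := h.exists_sum_le hcube
  exact (ae_longCubes hν hD hle).mono fun w hw => hw.noEigenvalues V

end AlmostPrimitive

/-! ### The two-letter family -/

section Family

open Letter

variable {p : ℕ} {ks : List ℕ}

theorem sub_b (p : ℕ) (ks : List ℕ) :
    sub p ks b = ks.flatMap fun k => b :: List.replicate k a := rfl

/-- The shape of the list of parameters. -/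
theorem Admissible.exists_eq (h : Admissible p ks) :
    ∃ k₁ ks' l, ks = k₁ :: (ks' ++ [l]) ∧ ks.dropLast = k₁ :: ks' ∧ ks.getLastD 0 = l := by
  obtain ⟨-, h2, -⟩ := h
  match ks, h2 with
  | k₁ :: k₂ :: ks'', _ =>
    have hne : k₂ :: ks'' ≠ [] := by simp
    refine ⟨k₁, (k₂ :: ks'').dropLast, (k₂ :: ks'').getLast hne, ?_, by simp, ?_⟩
    · rw [List.dropLast_append_getLast]
    · simp [List.getLastD_eq_getLast?, List.getLast?_eq_some_getLast]

theorem Admissible.exists_sub_b (h : Admissible p ks) :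
    ∃ k u, sub p ks b = b :: (List.replicate k a ++ b :: u) := by
  obtain ⟨k₁, ks', l, hks, -, -⟩ := h.exists_eq
  cases ks' with
  | nil => exact ⟨k₁, List.replicate l a, by simp [sub_b, hks]⟩
  | cons k₂ ks' => exact ⟨k₁, _, by rw [sub_b, hks]; simp; rfl⟩

theorem substIter_a (p : ℕ) (ks : List ℕ) (n k : ℕ) :
    substIter (sub p ks) n (List.replicate k a) = List.replicate (p ^ n * k) a :=
  substIter_replicate (ϱ := sub p ks) rfl n k

theorem Admissible.image_ne_nil (h : Admissible p ks) (c : Letter) : sub p ks c ≠ [] := by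
  cases c with
  | a => have := h.1; simp [sub]; omega
  | b => obtain ⟨k, u, hu⟩ := h.exists_sub_b; simp [hu]

theorem substIter_ne_nil (h : Admissible p ks) (n : ℕ) {u : List Letter} (hu : u ≠ []) :
    substIter (sub p ks) n u ≠ [] := by
  have := length_le_length_substIter h.image_ne_nil n u
  rw [← List.length_pos_iff] at hu ⊢
  omega

/-- There is an element of the subshift that contains all words `ϱ^{2n}(b)`. -/
theorem Admissible.exists_universal (h : Admissible p ks) :
    ∃ w ∈ subshift (sub p ks), ∀ n, Occurs (substIter (sub p ks) (2 * n) [b]) w := by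
  obtain ⟨k, u, hu⟩ := h.exists_sub_b
  -- The second power is taken because the second `b` of `ϱ(b)` may be its last letter; in `ϱ²(b)`
  -- there is a `b` with letters on both sides.
  obtain ⟨X, Y, hX, hY, hXY⟩ : ∃ X Y, X ≠ [] ∧ Y ≠ [] ∧
      substIter (sub p ks) 2 [b] = X ++ [b] ++ Y := by
    refine ⟨b :: List.replicate k a, u ++ substIter (sub p ks) 1 (List.replicate k a ++ b :: u),
      by simp, ?_, ?_⟩
    · have := substIter_ne_nil h 1 (u := List.replicate k a ++ b :: u) (by simp)
      simp [this]
    · have e1 : substIter (sub p ks) 1 [b] = [b] ++ (List.replicate k a ++ b :: u) := by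
        simp [substIter, hu]
      have e2 : substIter (sub p ks) 2 [b] = substIter (sub p ks) 1 (substIter (sub p ks) 1 [b]) :=
        rfl
      rw [e2, e1, substIter_append, e1]
      simp
  obtain ⟨w, hw1, hw2⟩ := exists_nested_limit
    (W := fun n => substIter (sub p ks) (2 * n) [b])
    (X := fun n => substIter (sub p ks) (2 * n) X) (Y := fun n => substIter (sub p ks) (2 * n) Y)
    (fun n => substIter_ne_nil h _ hX) (fun n => substIter_ne_nil h _ hY)
    (fun n => by
      rw [mul_add, mul_one, substIter_add, hXY, substIter_append, substIter_append])
  refine ⟨w, fun j N => ?_, hw1⟩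
  obtain ⟨n, hn⟩ := hw2 j N
  refine ⟨b, 2 * n + 1, by omega, hn.trans ?_⟩
  rw [substIter_add]
  refine List.IsInfix.substIter _ _ (singleton_infix_of_mem ?_)
  simp [substIter, hu]

theorem Admissible.substIter_infix (h : Admissible p ks) {m n : ℕ} (hmn : m ≤ n) :
    substIter (sub p ks) m [b] <:+: substIter (sub p ks) n [b] := by
  induction n, hmn using Nat.le_induction with
  | base => exact List.infix_rfl
  | succ n _ ih =>
    refine ih.trans ?_
    obtain ⟨k, u, hu⟩ := h.exists_sub_b
    rw [substIter_add]
    exact (singleton_infix_of_mem (by simp [substIter, hu])).substIter _ _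

/-- All subwords of the words `ϱ^n(b)` are legal. -/
theorem Admissible.legal_of_infix (h : Admissible p ks) {n : ℕ} {v : List Letter}
    (hv : v <:+: substIter (sub p ks) n [b]) : Legal (sub p ks) v := by
  obtain ⟨w, hw, hocc⟩ := h.exists_universal
  exact ⟨w, hw, (hocc n).of_infix (hv.trans (h.substIter_infix (by omega)))⟩

/-- Legal words that contain the letter `b` are subwords of some `ϱ^n(b)`. -/
theorem exists_infix_of_legal {v : List Letter} (hv : Legal (sub p ks) v) (hb : b ∈ v) :
    ∃ n, v <:+: substIter (sub p ks) n [b] := by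
  obtain ⟨c, n, -, hc⟩ := hv.admitted
  cases c with
  | b => exact ⟨n, hc⟩
  | a =>
    have := substIter_a p ks n 1
    rw [List.replicate_one] at this
    rw [this] at hc
    have := List.eq_of_mem_replicate (hc.subset hb)
    cases this

theorem Admissible.a_mem (h : Admissible p ks) : a ∈ sub p ks b := by
  obtain ⟨-, -, hsum, -⟩ := h
  rw [sub_b, List.mem_flatMap]
  by_contra hcon
  push Not at hcon
  have : ks.sum = 0 := List.sum_eq_zero fun k hk => by
    have := hcon k hk
    simpa using this
  omega

theorem Admissible.isAlmostPrimitive (h : Admissible p ks) : IsAlmostPrimitive (sub p ks) a where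
  image_ne_nil := h.image_ne_nil
  map_a := ⟨p, h.1, rfl⟩
  unique_a := by
    rintro c ⟨q, -, hq⟩
    cases c with
    | a => rfl
    | b =>
      have := h.a_mem
      rw [hq] at this
      exact (List.eq_of_mem_replicate this).symm
  primitive := by
    refine ⟨1, fun d c hc => ?_⟩
    obtain ⟨k, u, hu⟩ := h.exists_sub_b
    cases c with
    | a => exact absurd rfl hc
    | b =>
      cases d with
      | a => simpa [substIter] using h.a_mem
      | b => simp [substIter, hu]
  pow_legal := by
    intro n
    obtain ⟨k₁, ks', l, hks, -, hl⟩ := h.exists_eq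
    -- If `p > 1`, a single `a` already expands to long powers; if `k_r > 0`, the final run of
    -- `ϱ^m(b)` grows by `p^m k_r` at each step.
    have key : ∃ m k, n ≤ k ∧ List.replicate k a <:+: substIter (sub p ks) m [b] := by
      rcases h.2.2.2 with hp | hk
      · refine ⟨n + 1, p ^ n * 1, by simpa using (Nat.lt_pow_self hp).le, ?_⟩
        rw [← substIter_a p ks, substIter_add]
        exact (singleton_infix_of_mem (by simpa [substIter] using h.a_mem)).substIter _ _
      · have hsuf : ∀ m, ∃ k, m ≤ k ∧ List.replicate k a <:+ substIter (sub p ks) m [b] := by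
          intro m
          induction m with
          | zero => exact ⟨0, le_rfl, by simp⟩
          | succ m ih =>
            obtain ⟨k, hk1, hk2⟩ := ih
            have e : substIter (sub p ks) 1 [b] = ((k₁ :: ks').flatMap fun k =>
                b :: List.replicate k a) ++ [b] ++ List.replicate l a := by
              simp [substIter, sub_b, hks]
            obtain ⟨s, hs⟩ := hk2
            have hpow : 0 < p ^ m := Nat.pow_pos h.1
            refine ⟨k + p ^ m * l, ?_, ?_⟩
            · rw [hl] at hk; nlinarith
            · rw [substIter_add, e, substIter_append, substIter_append, substIter_a, ← hs,
                List.replicate_add]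
              exact ⟨substIter (sub p ks) m ((k₁ :: ks').flatMap fun k =>
                b :: List.replicate k a) ++ s, by simp only [List.append_assoc]⟩
        obtain ⟨k, hk1, hk2⟩ := hsuf n
        exact ⟨n, k, hk1, hk2.isInfix⟩
    obtain ⟨m, k, hk, hin⟩ := key
    refine h.legal_of_infix (n := m) (List.IsInfix.trans ?_ hin)
    obtain ⟨j, rfl⟩ := Nat.exists_eq_add_of_le hk
    rw [List.replicate_add]
    exact (List.prefix_append _ _).isInfix

theorem PropStar.hasCubePlus (h : PropStar p ks) : HasCubePlus (sub p ks) a := by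
  obtain ⟨v, -, hv⟩ := h
  exact ⟨b, v, by simp, by simpa [Legal] using hv⟩

end Family

/-! ### Return words -/

section ReturnWords

open Letter

/-- The word over `{a, b}` that is coded by a word over the return words. -/
def decode (l : List ℕ) : List Letter := l.flatMap fun k => b :: List.replicate k a

/-- The number of leading letters `a`, and the code of the remaining word. -/
def encode : List Letter → ℕ × List ℕ
  | [] => (0, [])
  | a :: x => ((encode x).1 + 1, (encode x).2)
  | b :: x => (0, (encode x).1 :: (encode x).2)

@[simp] theorem decode_nil : decode [] = [] := rfl

theorem decode_cons (k : ℕ) (l : List ℕ) :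
    decode (k :: l) = b :: (List.replicate k a ++ decode l) := by simp [decode]

theorem decode_append (l l' : List ℕ) : decode (l ++ l') = decode l ++ decode l' := by
  simp [decode]

/-- With `decode_encode`, this makes the cutting of a word before each `b` unique, so that
occurrences can be compared on the level of codes. -/
theorem encode_decode (i : ℕ) (l : List ℕ) :
    encode (List.replicate i a ++ decode l) = (i, l) := by
  induction l generalizing i with
  | nil =>
    induction i with
    | zero => rfl
    | succ i ih => simp [List.replicate_succ, encode] at ih ⊢; simp [ih]
  | cons k l ihl =>
    induction i with
    | zero => rw [List.replicate_zero, List.nil_append, decode_cons, encode, ihl]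
    | succ i ih => rw [List.replicate_succ, List.cons_append, encode, ih]

theorem decode_encode (x : List Letter) :
    List.replicate (encode x).1 a ++ decode (encode x).2 = x := by
  induction x with
  | nil => rfl
  | cons c x ih =>
    cases c with
    | a => rw [encode, List.replicate_succ, List.cons_append, ih]
    | b => rw [encode, decode_cons, ih]; rfl

theorem exists_decode_cons (x : List Letter) : ∃ k l, b :: x = decode (k :: l) :=
  ⟨_, _, by rw [decode_cons, decode_encode]⟩

/-- A coded word, continued by `b`, can only occur in a coded word in the obvious way. -/
theorem exists_infix_of_decode_infix {M L : List ℕ} (h : decode M ++ [b] <:+: decode L) :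
    ∃ k, M ++ [k] <:+: L := by
  obtain ⟨s, t, hst⟩ := h
  obtain ⟨k, T, hT⟩ := exists_decode_cons t
  have h1 := encode_decode 0 L
  have h2 := encode_decode (encode s).1 ((encode s).2 ++ (M ++ (k :: T)))
  rw [decode_append, decode_append, ← hT, ← List.append_assoc, decode_encode] at h2
  rw [List.replicate_zero, List.nil_append, ← hst, List.append_assoc, List.append_assoc,
    List.singleton_append, h2, Prod.mk.injEq] at h1
  exact ⟨k, (encode s).2, T, by rw [← h1.2]; simp⟩

/-- Removes the last return word, whose run of `a` is cut off at the end of `ϱ^n(b)` and hence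
carries no information. -/
theorem infix_of_concat_infix_concat {α : Type*} {M L : List α} {k x : α}
    (h : M ++ [k] <:+: L ++ [x]) : M <:+: L := by
  obtain ⟨s, t, hst⟩ := h
  rcases List.eq_nil_or_concat t with rfl | ⟨t', x', rfl⟩
  · rw [List.append_nil, ← List.append_assoc] at hst
    exact ⟨s, [], by rw [List.append_nil]; exact (List.append_inj' hst rfl).1⟩
  · rw [List.concat_eq_append, ← List.append_assoc] at hst
    exact ⟨s, [k] ++ t', by rw [← (List.append_inj' hst rfl).1]; simp⟩

variable {p : ℕ} {ks : List ℕ}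

theorem Admissible.dropLast_concat (h : Admissible p ks) : ks.dropLast ++ [ks.getLastD 0] = ks := by
  obtain ⟨k₁, ks', l, h1, h2, h3⟩ := h.exists_eq
  rw [h2, h3, h1]
  rfl

/-- On return words, `ϱ^n` acts as the return word substitution. -/
theorem Admissible.substIter_decode (h : Admissible p ks) (n : ℕ) (l : List ℕ) :
    substIter (sub p ks) n (decode l) =
      decode (l.flatMap fun k => beta p ks n ++ [(affine p ks)^[n] k]) := by
  -- The image `a^{pk}` of the run merges with the final run `a^{k_r}` of `ϱ(b)`, which produces
  -- `f(k)`.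
  have hsingle : ∀ k, (decode [k]).flatMap (sub p ks) =
      decode (ks.dropLast ++ [affine p ks k]) := by
    intro k
    have e1 := substIter_a p ks 1 k
    have e2 : sub p ks b = decode ks := rfl
    simp only [substIter, Function.iterate_one, pow_one] at e1
    rw [decode_cons, decode_nil, List.append_nil, List.flatMap_cons, e1, e2,
      ← h.dropLast_concat, decode_append, decode_append, List.dropLast_concat,
      List.append_assoc]
    simp [decode_cons, affine]
  induction n generalizing l with
  | zero => simp [substIter_zero, beta]
  | succ n ih =>
    have happ : ∀ l, (decode l).flatMap (sub p ks) =
        decode (l.flatMap fun k => ks.dropLast ++ [affine p ks k]) := by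
      intro l
      induction l with
      | nil => rfl
      | cons k l ihl =>
        rw [List.flatMap_cons, decode_append, ← ihl, ← hsingle, ← List.flatMap_append,
          ← decode_append]
        rfl
    rw [substIter_succ, happ, ih]
    congr 1
    rw [List.flatMap_assoc]
    congr 1
    funext k
    simp [beta]

theorem Admissible.substIter_b (h : Admissible p ks) (n : ℕ) :
    substIter (sub p ks) n [b] = decode (beta p ks n ++ [(affine p ks)^[n] 0]) := by
  have := h.substIter_decode n [0]
  simpa [decode_cons] using this

theorem singleton_prefix_decode (k : ℕ) (l : List ℕ) : [b] <+: decode (k :: l) := by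
  rw [decode_cons]; exact ⟨_, rfl⟩

theorem decode_concat_infix {M L : List ℕ} (k : ℕ) (h : M <:+: L) :
    decode M ++ [b] <:+: decode (L ++ [k]) := by
  obtain ⟨s, t, rfl⟩ := h
  obtain ⟨k', l', hl⟩ : ∃ k' l', t ++ [k] = k' :: l' := by
    cases t <;> simp
  obtain ⟨u, hu⟩ := singleton_prefix_decode k' l'
  refine ⟨decode s, u, ?_⟩
  rw [List.append_assoc (s ++ M), hl, decode_append, decode_append, ← hu]
  simp

/-- Subwords of `β^{(n)}` code legal words. -/
theorem Admissible.legal_of_infix_beta (h : Admissible p ks) {n : ℕ} {M : List ℕ}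
    (hM : M <:+: beta p ks n) : Legal (sub p ks) (decode M ++ [b]) :=
  h.legal_of_infix (n := n) (by rw [h.substIter_b]; exact decode_concat_infix _ hM)

theorem Admissible.mem_retLetters (h : Admissible p ks) {n k : ℕ} (hk : k ∈ beta p ks n) :
    k ∈ retLetters p ks := by
  have := h.legal_of_infix_beta (singleton_infix_of_mem hk)
  simpa [retLetters, decode_cons] using this

/-- Legal words that are coded by return words come from some `β^{(n)}`. -/
theorem Admissible.exists_infix_beta (h : Admissible p ks) {M : List ℕ}
    (hM : Legal (sub p ks) (decode M ++ [b])) : ∃ n, M <:+: beta p ks n := by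
  obtain ⟨n, hn⟩ := exists_infix_of_legal hM (by simp)
  rw [h.substIter_b] at hn
  obtain ⟨k, hk⟩ := exists_infix_of_decode_infix hn
  exact ⟨n, infix_of_concat_infix_concat hk⟩

/-- Apply `ϱ^n` to `b a^k b`, coded by `[k, 0]`; the block of the auxiliary `0` supplies the second
`β^{(n)}` and the closing `b`. -/
theorem Admissible.legal_beta_concat (h : Admissible p ks) {n k : ℕ} (hk : k ∈ retLetters p ks) :
    Legal (sub p ks) (decode (beta p ks n ++ [(affine p ks)^[n] k] ++ beta p ks n) ++ [b]) := by
  obtain ⟨m, hm⟩ := exists_infix_of_legal hk (by simp)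
  have e : b :: (List.replicate k a ++ [b]) = decode [k, 0] := by simp [decode_cons]
  rw [e] at hm
  have h2 := hm.substIter (sub p ks) n
  rw [h.substIter_decode, ← substIter_add] at h2
  refine h.legal_of_infix (List.IsInfix.trans ?_ h2)
  have := decode_concat_infix ((affine p ks)^[n] 0)
    (List.infix_refl (beta p ks n ++ [(affine p ks)^[n] k] ++ beta p ks n))
  simpa using this

/-- The `b` opening the return word after the coded cube is the extra first letter that a cube in
the letters must be followed by. -/
theorem hasCubePlus_of_legal {v L : List ℕ} (hv : v ≠ []) (hvL : v ++ v ++ v <:+: L)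
    (hL : Legal (sub p ks) (decode L ++ [b])) : HasCubePlus (sub p ks) a := by
  obtain ⟨k, v', rfl⟩ := List.exists_cons_of_ne_nil hv
  refine ⟨b, List.replicate k a ++ decode v', by simp, hL.of_infix ?_⟩
  have := decode_concat_infix 0 hvL
  rw [decode_append, decode_append, decode_append, decode_cons] at this
  refine this.trans ⟨[], [], by simp [decode_cons]⟩

theorem Admissible.exists_cube_infix_beta (h : Admissible p ks) (hc : HasCubePlus (sub p ks) a) :
    ∃ n, ∃ v ≠ [], v ++ v ++ v <:+: beta p ks n := by
  obtain ⟨c, t, hc, hleg⟩ := hc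
  cases c with
  | a => exact absurd rfl hc
  | b =>
    obtain ⟨k, l, hkl⟩ := exists_decode_cons t
    rw [hkl, ← decode_append, ← decode_append] at hleg
    obtain ⟨n, hn⟩ := h.exists_infix_beta hleg
    exact ⟨n, k :: l, by simp, hn⟩

theorem Admissible.propStar_of_hasCubePlus (h : Admissible p ks)
    (hc : HasCubePlus (sub p ks) a) : PropStar p ks := by
  obtain ⟨c, t, hc, hleg⟩ := hc
  cases c with
  | a => exact absurd rfl hc
  | b =>
    by_cases ht : t = []
    -- Here the cube is `b b b b`, with nothing between the `b`s; applying `ϱ` once replaces `b` by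
    -- the longer block `ϱ(b)`.
    · subst ht
      obtain ⟨n, hn⟩ := exists_infix_of_legal hleg (by simp)
      obtain ⟨k, u, hu⟩ := h.exists_sub_b
      refine ⟨List.replicate k a ++ b :: u, by simp, h.legal_of_infix (n := 1 + n) ?_⟩
      rw [substIter_add]
      refine List.IsInfix.trans ?_ (hn.substIter (sub p ks) 1)
      refine ⟨[], List.replicate k a ++ b :: u, ?_⟩
      simp [substIter, hu]
    · exact ⟨t, ht, by simpa [Legal] using hleg⟩

/-- There is an element of the return word subshift that contains all words `β^{(n)}`. -/
theorem Admissible.exists_mem_retSubshift (h : Admissible p ks) :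
    ∃ x ∈ retSubshift p ks, ∀ n, Occurs ((beta p ks (2 * n)).map fun j : ℕ => (j : OnePoint ℕ)) x := by
  obtain ⟨k₁, ks', l, -, hks, -⟩ := h.exists_eq
  have hpre : ∀ n, ∃ T, beta p ks (n + 1) = beta p ks n ++ [(affine p ks)^[n] k₁] ++ T := by
    intro n
    exact ⟨_, by rw [beta, hks]; simp; rfl⟩
  have hsuf : ∀ n, ∃ S, S ≠ [] ∧ beta p ks (n + 1) = S ++ beta p ks n := by
    intro n
    exact ⟨_, by simp [hks], rfl⟩
  -- Each `β` is both a prefix and a suffix of the next one. Using it once as a suffix and once as a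
  -- prefix gives growth on both sides, which is why two levels are taken together.
  have hXY : ∀ n, ∃ XY : List ℕ × List ℕ, XY.1 ≠ [] ∧ XY.2 ≠ [] ∧
      beta p ks (2 * (n + 1)) = XY.1 ++ beta p ks (2 * n) ++ XY.2 := by
    intro n
    obtain ⟨T, hT⟩ := hpre (2 * n + 1)
    obtain ⟨S, hS, hST⟩ := hsuf (2 * n)
    refine ⟨(S, [(affine p ks)^[2 * n + 1] k₁] ++ T), hS, by simp, ?_⟩
    rw [show 2 * (n + 1) = 2 * n + 1 + 1 by ring, hT, hST]
    simp
  choose XY hX hY hXY using hXY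
  obtain ⟨x, hx1, hx2⟩ := exists_nested_limit
    (W := fun n => (beta p ks (2 * n)).map fun j : ℕ => (j : OnePoint ℕ))
    (X := fun n => (XY n).1.map fun j : ℕ => (j : OnePoint ℕ))
    (Y := fun n => (XY n).2.map fun j : ℕ => (j : OnePoint ℕ))
    (fun n => by simpa using hX n) (fun n => by simpa using hY n)
    (fun n => by rw [hXY]; simp)
  refine ⟨x, fun j N => subset_closure ?_, hx1⟩
  obtain ⟨n, hn⟩ := hx2 j N
  have hk : k₁ ∈ retLetters p ks := h.mem_retLetters (n := 1) (by simp [beta, hks])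
  refine ⟨(k₁ : ℕ), Set.mem_insert_of_mem _ ⟨k₁, hk, rfl⟩, 2 * (n + 1), by omega, ?_⟩
  rw [substIter_retSub]
  refine List.IsInfix.trans hn (List.IsInfix.map _ ?_)
  rw [hXY]
  exact ⟨(XY n).1, (XY n).2 ++ [(affine p ks)^[2 * (n + 1)] k₁], by simp⟩

theorem infix_beta_of_le {m n : ℕ} (hmn : m ≤ n) :
    beta p ks m <:+: beta p ks n := by
  induction n, hmn using Nat.le_induction with
  | base => exact List.infix_rfl
  | succ n _ ih => exact ih.trans (List.suffix_append _ _).isInfix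

/-- Ensures that the membership in `ℒ'` required by the finite check is automatic for the cubes
found in the Toeplitz sequence. -/
theorem Admissible.retLegal_of_infix (h : Admissible p ks) {n : ℕ} {v : List ℕ} (hv : v ≠ [])
    (hvn : v <:+: beta p ks n) : RetLegal p ks v := by
  obtain ⟨x, hx, hocc⟩ := h.exists_mem_retSubshift
  refine ⟨hv, fun k hk => h.mem_retLetters (hvn.subset hk), x, hx, (hocc n).of_infix ?_⟩
  exact List.IsInfix.map _ (hvn.trans (infix_beta_of_le (by omega)))

end ReturnWords

/-! ### The one-sided Toeplitz sequence of return words -/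

section Toeplitz

/-- The one-sided infinite word (indexed from `1`) that has all words `β^{(n)}` as prefixes: it is
`k_1, …, k_{r-1}` between multiples of `r`, and its values at multiples of `r` are obtained from
itself by applying `f`. -/
def retSeq (p : ℕ) (ks : List ℕ) (i : ℕ) : ℕ :=
  if h : 2 ≤ ks.length ∧ 0 < i ∧ ks.length ∣ i then
    affine p ks (retSeq p ks (i / ks.length))
  else ks.getD (i % ks.length - 1) 0
termination_by i
decreasing_by exact Nat.div_lt_self h.2.1 h.1

variable {p : ℕ} {ks : List ℕ}

theorem retSeq_of_not_dvd {i : ℕ} (hi : ¬ ks.length ∣ i) :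
    retSeq p ks i = ks.getD (i % ks.length - 1) 0 := by
  rw [retSeq, dif_neg (fun h => hi h.2.2)]

theorem retSeq_mul (hr : 2 ≤ ks.length) {i : ℕ} (hi : 0 < i) :
    retSeq p ks (ks.length * i) = affine p ks (retSeq p ks i) := by
  have h0 : 0 < ks.length := by omega
  rw [retSeq, dif_pos ⟨hr, by positivity, dvd_mul_right _ _⟩, Nat.mul_div_cancel_left _ h0]

theorem retSeq_mul_pow (hr : 2 ≤ ks.length) (n : ℕ) {t : ℕ} (ht : 0 < t) :
    retSeq p ks (t * ks.length ^ n) = (affine p ks)^[n] (retSeq p ks t) := by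
  have h0 : 0 < ks.length := by omega
  induction n with
  | zero => simp
  | succ n ih =>
    rw [pow_succ, ← mul_assoc, mul_comm _ ks.length, retSeq_mul hr (by positivity), ih,
      Function.iterate_succ_apply']

/-- The Toeplitz property: common factors `r` are divided out at the cost of equally many `f`s. As
`0 < i < r^n`, a position not divisible by `r` is reached while `t` still has a factor `r` in front,
and there only the residue matters. -/
theorem retSeq_mul_pow_add (hr : 2 ≤ ks.length) (n t : ℕ) {i : ℕ} (hi : 0 < i)
    (hin : i < ks.length ^ n) : retSeq p ks (t * ks.length ^ n + i) = retSeq p ks i := by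
  induction n generalizing i with
  | zero => rw [pow_zero] at hin; omega
  | succ n ih =>
    by_cases hd : ks.length ∣ i
    · obtain ⟨i', rfl⟩ := hd
      have h0 : 0 < i' := Nat.pos_of_mul_pos_left hi
      rw [pow_succ, mul_comm _ ks.length] at hin ⊢
      rw [← mul_assoc, mul_comm t, mul_assoc, ← mul_add, retSeq_mul hr (by omega),
        retSeq_mul hr h0, ih h0 (Nat.lt_of_mul_lt_mul_left hin)]
    · have hd' : ¬ ks.length ∣ t * ks.length ^ (n + 1) + i := by
        rwa [Nat.dvd_add_right]
        exact Dvd.dvd.mul_left (dvd_pow_self _ (by omega)) _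
      rw [retSeq_of_not_dvd hd, retSeq_of_not_dvd hd', pow_succ, ← mul_assoc,
        Nat.mul_add_mod_self_right]

theorem retSeq_skeleton {i j : ℕ} (hi : ¬ ks.length ∣ i) (hij : i % ks.length = j % ks.length) :
    retSeq p ks i = retSeq p ks j := by
  have hj : ¬ ks.length ∣ j := by
    rwa [Nat.dvd_iff_mod_eq_zero, ← hij, ← Nat.dvd_iff_mod_eq_zero]
  rw [retSeq_of_not_dvd hi, retSeq_of_not_dvd hj, hij]

/-- The finite subword of length `n` that starts at position `s`. -/
def retSeg (p : ℕ) (ks : List ℕ) (s n : ℕ) : List ℕ := (List.range' s n).map (retSeq p ks)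

@[simp] theorem length_retSeg (s n : ℕ) : (retSeg p ks s n).length = n := by simp [retSeg]

theorem getElem?_retSeg {s n i : ℕ} (h : i < n) :
    (retSeg p ks s n)[i]? = some (retSeq p ks (s + i)) := by
  simp [retSeg, h]

theorem retSeg_add (s m n : ℕ) :
    retSeg p ks s (m + n) = retSeg p ks s m ++ retSeg p ks (s + m) n := by
  rw [retSeg, retSeg, retSeg, ← List.map_append, List.range'_append_1]

theorem retSeg_congr {s t n : ℕ} (h : ∀ i < n, retSeq p ks (s + i) = retSeq p ks (t + i)) :
    retSeg p ks s n = retSeg p ks t n := by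
  apply List.ext_getElem?
  intro i
  by_cases hi : i < n
  · rw [getElem?_retSeg hi, getElem?_retSeg hi, h i hi]
  · rw [List.getElem?_eq_none (by simpa using hi), List.getElem?_eq_none (by simpa using hi)]

theorem retSeg_infix {s t m n : ℕ} (h1 : t ≤ s) (h2 : s + m ≤ t + n) :
    retSeg p ks s m <:+: retSeg p ks t n := by
  obtain ⟨d, rfl⟩ := Nat.exists_eq_add_of_le h1
  obtain ⟨e, he⟩ := Nat.exists_eq_add_of_le (show d + m ≤ n by omega)
  exact ⟨retSeg p ks t d, retSeg p ks (t + d + m) e, by rw [he, retSeg_add, retSeg_add, add_assoc]⟩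

theorem exists_of_infix_retSeg {v : List ℕ} {s n : ℕ} (h : v <:+: retSeg p ks s n) :
    ∃ t, s ≤ t ∧ t + v.length ≤ s + n ∧ v = retSeg p ks t v.length := by
  obtain ⟨x, y, hxy⟩ := h
  have hlen := congrArg List.length hxy
  simp only [List.length_append, length_retSeg] at hlen
  refine ⟨s + x.length, by omega, by omega, ?_⟩
  rw [← hlen, retSeg_add, retSeg_add] at hxy
  have h1 := (List.append_inj hxy (by simp)).1
  exact (List.append_inj h1 (by simp)).2

theorem Admissible.dropLast_eq (h : Admissible p ks) :
    ks.dropLast = retSeg p ks 1 (ks.length - 1) := by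
  have hr := h.2.1
  apply List.ext_getElem?
  intro i
  by_cases hi : i < ks.length - 1
  · have hmod : (1 + i) % ks.length = 1 + i := Nat.mod_eq_of_lt (by omega)
    have hd : ¬ ks.length ∣ 1 + i := by
      rw [Nat.dvd_iff_mod_eq_zero, hmod]; omega
    rw [getElem?_retSeg hi, retSeq_of_not_dvd hd, hmod, Nat.add_sub_cancel_left,
      List.getElem?_dropLast, if_pos hi, List.getD_eq_getElem?_getD,
      List.getElem?_eq_getElem (by omega)]
    rfl
  · rw [List.getElem?_eq_none (by simpa using hi), List.getElem?_eq_none (by simpa using hi)]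

theorem Admissible.retSeg_block (h : Admissible p ks) (n t : ℕ) :
    retSeg p ks (t * ks.length ^ n + 1) (ks.length ^ n - 1) =
      retSeg p ks 1 (ks.length ^ n - 1) :=
  retSeg_congr fun i hi => by
    rw [add_assoc, retSeq_mul_pow_add h.2.1 n t (by omega) (by omega)]

/-- The words `β^{(n)}` are the prefixes of length `r^n - 1`. -/
theorem Admissible.beta_eq (h : Admissible p ks) (n : ℕ) :
    beta p ks n = retSeg p ks 1 (ks.length ^ n - 1) := by
  induction n with
  | zero => simp [beta, retSeg]
  | succ n ih =>
    have hr := h.2.1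
    have hpos : 0 < ks.length ^ n := by positivity
    -- Each block has length `r^n`, and its last letter sits at a multiple of `r^n`, where the
    -- sequence is an `n`-fold `f`-image of itself.
    have key : ∀ m, ((retSeg p ks 1 m).flatMap fun j => beta p ks n ++ [(affine p ks)^[n] j]) =
        retSeg p ks 1 (m * ks.length ^ n) := by
      intro m
      induction m with
      | zero => simp [retSeg]
      | succ m ihm =>
        have e1 : ks.length ^ n = (ks.length ^ n - 1) + 1 := by omega
        have e2 : retSeg p ks (1 + m * ks.length ^ n) (ks.length ^ n) =
            retSeg p ks 1 (ks.length ^ n - 1) ++ [(affine p ks)^[n] (retSeq p ks (1 + m))] := by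
          rw [← h.retSeg_block n m, ← retSeq_mul_pow h.2.1 n (by omega)]
          nth_rewrite 2 [e1]
          rw [retSeg_add, add_comm 1 (m * _)]
          congr 1
          simp only [retSeg, List.range'_one, List.map_cons, List.map_nil]
          congr 2
          rw [add_assoc, Nat.add_sub_cancel' hpos]
          ring
        rw [retSeg_add, List.flatMap_append, ihm, add_mul, one_mul, retSeg_add, e2, ← ih]
        simp [retSeg]
    rw [beta, h.dropLast_eq, key, ih, ← h.retSeg_block n (ks.length - 1), add_comm _ 1,
      ← retSeg_add]
    congr 1
    obtain ⟨d, hd⟩ := Nat.exists_eq_add_of_le' (show 1 ≤ ks.length by omega)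
    rw [hd, Nat.add_sub_cancel, pow_succ, mul_add, mul_one, mul_comm, ← hd]
    omega

/-- The block around a multiple of `r^n`. -/
theorem Admissible.beta_concat_eq (h : Admissible p ks) (n : ℕ) {t : ℕ} (ht : 0 < t) :
    beta p ks n ++ [(affine p ks)^[n] (retSeq p ks t)] ++ beta p ks n =
      retSeg p ks ((t - 1) * ks.length ^ n + 1) (ks.length ^ n - 1 + 1 + (ks.length ^ n - 1)) := by
  have hr := h.2.1
  have hpos : 0 < ks.length ^ n := by positivity
  obtain ⟨t, rfl⟩ := Nat.exists_eq_add_of_le' ht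
  have e : t * ks.length ^ n + 1 + (ks.length ^ n - 1) = (t + 1) * ks.length ^ n := by
    rw [add_mul]; omega
  rw [Nat.add_sub_cancel, retSeg_add, retSeg_add, ← add_assoc _ _ 1, e, h.retSeg_block,
    h.retSeg_block, h.beta_eq, ← retSeq_mul_pow h.2.1 n ht]
  simp [retSeg]

theorem Admissible.retSeq_mem (h : Admissible p ks) {i : ℕ} (hi : 0 < i) :
    retSeq p ks i ∈ retLetters p ks := by
  refine h.mem_retLetters (n := i) ?_
  have : i < ks.length ^ i := Nat.lt_pow_self h.2.1
  rw [h.beta_eq, retSeg]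
  exact List.mem_map_of_mem (List.mem_range'_1.2 ⟨hi, by omega⟩)

theorem Admissible.le_affine (h : Admissible p ks) (k : ℕ) : k ≤ affine p ks k := by
  have := h.1
  rw [affine]
  nlinarith

theorem Admissible.affine_injective (h : Admissible p ks) :
    Function.Injective (affine p ks) := by
  intro x y hxy
  have h1 : p * x = p * y := by simpa [affine] using hxy
  exact Nat.eq_of_mul_eq_mul_left h.1 h1

/-- Every value of the sequence is attained at an early position. -/
theorem Admissible.exists_retSeq_eq (h : Admissible p ks) {t : ℕ} (ht : 0 < t) :
    ∃ t', 0 < t' ∧ t' < ks.length ^ (retSeq p ks t + 1) ∧ retSeq p ks t' = retSeq p ks t := by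
  have hr := h.2.1
  induction t using Nat.strong_induction_on with
  | _ t ih =>
    by_cases hd : ks.length ∣ t
    · obtain ⟨s, rfl⟩ := hd
      have hs : 0 < s := Nat.pos_of_mul_pos_left ht
      obtain ⟨s', h1, h2, h3⟩ := ih s (by nlinarith) hs
      rw [retSeq_mul hr hs]
      -- If `f` fixes the value, the earlier position is reused; otherwise the value increases,
      -- which pays for one more factor `r` in the position.
      rcases (h.le_affine (retSeq p ks s)).eq_or_lt with heq | hlt
      · exact ⟨s', h1, by rwa [← heq], by rwa [← heq]⟩
      · refine ⟨ks.length * s', by positivity, ?_, by rw [retSeq_mul hr h1, h3]⟩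
        calc ks.length * s' < ks.length * ks.length ^ (retSeq p ks s + 1) :=
              Nat.mul_lt_mul_of_pos_left h2 (by omega)
          _ = ks.length ^ (retSeq p ks s + 2) := by ring
          _ ≤ _ := Nat.pow_le_pow_right (by omega) (by omega)
    · refine ⟨t % ks.length, Nat.pos_of_ne_zero fun h0 => hd (Nat.dvd_of_mod_eq_zero h0), ?_, ?_⟩
      · calc t % ks.length < ks.length ^ 1 := by rw [pow_one]; exact Nat.mod_lt _ (by omega)
          _ ≤ _ := Nat.pow_le_pow_right (by omega) (by omega)
      · exact (retSeq_skeleton hd (Nat.mod_mod _ _).symm).symm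

/-! ### Cubes in the Toeplitz sequence -/

/-- There is a cube of period `m` at position `s`. -/
def CubeFrom (p : ℕ) (ks : List ℕ) (s m : ℕ) : Prop :=
  ∀ i < 2 * m, retSeq p ks (s + i) = retSeq p ks (s + i + m)

theorem CubeFrom.retSeg_eq {s m : ℕ} (h : CubeFrom p ks s m) :
    retSeg p ks s m ++ retSeg p ks s m ++ retSeg p ks s m = retSeg p ks s (3 * m) := by
  have e1 : retSeg p ks s m = retSeg p ks (s + m) m :=
    retSeg_congr fun i hi => by rw [h i (by omega)]; congr 1; ring
  have e2 : retSeg p ks (s + m) m = retSeg p ks (s + (m + m)) m :=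
    retSeg_congr fun i hi => by
      rw [show s + m + i = s + (m + i) by ring, h (m + i) (by omega)]; congr 1; ring
  rw [show 3 * m = m + m + m by ring, retSeg_add, retSeg_add, ← e2, ← e1]

theorem cubeFrom_of_infix {v : List ℕ} {s n : ℕ} (h : v ++ v ++ v <:+: retSeg p ks s n) :
    ∃ t, s ≤ t ∧ t + 3 * v.length ≤ s + n ∧ CubeFrom p ks t v.length := by
  obtain ⟨t, h1, h2, h3⟩ := exists_of_infix_retSeg h
  have hlen : (v ++ v ++ v).length = 3 * v.length := by simp only [List.length_append]; ring
  rw [hlen] at h2 h3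
  refine ⟨t, h1, h2, fun i hi => ?_⟩
  have e1 : (v ++ v ++ v)[i]? = (v ++ v ++ v)[i + v.length]? := by
    conv_rhs => rw [List.append_assoc, List.getElem?_append_right (by omega),
      Nat.add_sub_cancel]
    rw [List.getElem?_append_left (by rw [List.length_append]; omega)]
  rw [h3, getElem?_retSeg (by omega), getElem?_retSeg (by omega)] at e1
  rw [add_assoc]
  exact Option.some_injective _ e1

/-- A cube whose period is a multiple of `r` comes from a cube with a shorter period. -/
theorem Admissible.cubeFrom_div (h : Admissible p ks) {s m : ℕ} (hs : 0 < s)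
    (hc : CubeFrom p ks s (ks.length * m)) : ∃ t, 0 < t ∧ CubeFrom p ks t m := by
  have hr := h.2.1
  set r := ks.length with hrdef
  -- The quotient is `⌈s / r⌉`; the `2m` consecutive multiples of `r` from there on just fit into
  -- the range of comparison.
  have ht1 : s ≤ r * ((s + r - 1) / r) := by
    have h1 := Nat.div_add_mod (s + r - 1) r
    have h2 := Nat.mod_lt (s + r - 1) (show 0 < r by omega)
    omega
  have ht2 : r * ((s + r - 1) / r) ≤ s + r - 1 := Nat.mul_div_le _ _
  set t := (s + r - 1) / r with ht
  have ht0 : 0 < t := by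
    rcases Nat.eq_zero_or_pos t with h0 | h0
    · rw [h0] at ht1; omega
    · exact h0
  refine ⟨t, ht0, fun i hi => h.affine_injective ?_⟩
  have hri : r * (i + 1) ≤ r * (2 * m) := Nat.mul_le_mul_left _ hi
  have h3 := hc (r * t + r * i - s) (by
    rw [mul_add] at hri
    have : r * (2 * m) = 2 * (r * m) := by ring
    omega)
  rw [Nat.add_sub_cancel' (by omega), ← mul_add, ← mul_add, retSeq_mul hr (by omega),
    retSeq_mul hr (by omega)] at h3
  exact h3

/-- A long cube whose period is not a multiple of `r` contains a cube with period below `r`. -/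
theorem Admissible.cubeFrom_mod (h : Admissible p ks) {s m : ℕ} (hm : ks.length ≤ m)
    (hd : ¬ ks.length ∣ m) (hc : CubeFrom p ks s m) : CubeFrom p ks s (m % ks.length) := by
  have hr := h.2.1
  set r := ks.length with hrdef
  have hc' : ∀ x, s ≤ x → x < s + 2 * m → retSeq p ks x = retSeq p ks (x + m) := by
    intro x h1 h2
    have := hc (x - s) (by omega)
    rwa [Nat.add_sub_cancel' h1] at this
  -- Off the multiples of `r` this holds everywhere. A multiple of `r` is moved by `m` to a position
  -- with non-zero residue, where the comparison is possible.
  have hper : ∀ x, s ≤ x → x + r < s + 3 * m → retSeq p ks x = retSeq p ks (x + r) := by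
    intro x h1 h2
    by_cases hx : r ∣ x
    · by_cases hx2 : x + r < s + 2 * m
      · rw [hc' x h1 (by omega), hc' (x + r) (by omega) hx2]
        refine retSeq_skeleton ?_ ?_
        · rwa [← hrdef, Nat.dvd_add_right hx]
        · rw [← hrdef, add_right_comm, Nat.add_mod_right]
      -- There is no room on the right, so the shift goes left; `x - m` stays at or after `s`
      -- because `r ≤ m`.
      · have e1 := hc' (x - m) (by omega) (by omega)
        have e2 := hc' (x + r - m) (by omega) (by omega)
        rw [Nat.sub_add_cancel (by omega)] at e1 e2
        rw [← e1, ← e2]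
        refine retSeq_skeleton ?_ ?_
        · intro hdm
          have := Nat.dvd_sub hx hdm
          rw [Nat.sub_sub_self (by omega)] at this
          exact hd this
        · rw [← hrdef, show x + r - m = x - m + r by omega, Nat.add_mod_right]
    · refine retSeq_skeleton hx ?_
      rw [← hrdef, Nat.add_mod_right]
  have hmul : ∀ k x, s ≤ x → x + k * r < s + 3 * m →
      retSeq p ks x = retSeq p ks (x + k * r) := by
    intro k
    induction k with
    | zero => intro x _ _; simp
    | succ k ih =>
      intro x h1 h2
      rw [add_mul, one_mul] at h2 ⊢
      rw [ih x h1 (by omega), ← add_assoc]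
      exact hper _ (by omega) (by omega)
  intro i hi
  have hmod := Nat.mod_add_div m r
  have hlt := Nat.mod_lt m (show 0 < r by omega)
  rw [mul_comm] at hmod
  rw [hc i (by omega), hmul (m / r) (s + i + m % r) (by omega) (by omega)]
  congr 1
  omega

/-- If there is a cube, then there is one with period below `r`. -/
theorem Admissible.exists_short_cube (h : Admissible p ks) {s m : ℕ} (hs : 0 < s) (hm : 0 < m)
    (hc : CubeFrom p ks s m) :
    ∃ t n, 0 < t ∧ 0 < n ∧ n < ks.length ∧ CubeFrom p ks t n := by
  induction m using Nat.strong_induction_on generalizing s with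
  | _ m ih =>
    have hr := h.2.1
    rcases lt_or_ge m ks.length with hlt | hge
    · exact ⟨s, m, hs, hm, hlt, hc⟩
    · by_cases hd : ks.length ∣ m
      · obtain ⟨m', rfl⟩ := hd
        obtain ⟨t, ht, hct⟩ := h.cubeFrom_div hs hc
        have hm' : 0 < m' := Nat.pos_of_mul_pos_left hm
        exact ih m' (by nlinarith) ht hm' hct
      · exact ⟨s, m % ks.length, hs,
          Nat.pos_of_ne_zero fun h0 => hd (Nat.dvd_of_mod_eq_zero h0),
          Nat.mod_lt _ (by omega), h.cubeFrom_mod hge hd hc⟩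

theorem le_kMax_of_mem {k : ℕ} (hk : k ∈ ks.dropLast) : k ≤ kMax ks := by
  rw [kMax]
  generalize ks.dropLast = l at hk
  induction l with
  | nil => simp at hk
  | cons x l ih =>
    rw [List.foldr_cons]
    rcases List.mem_cons.1 hk with rfl | h
    · exact le_max_left _ _
    · exact (ih h).trans (le_max_right _ _)

theorem Admissible.retSeq_le_kMax (h : Admissible p ks) {i : ℕ} (hi : ¬ ks.length ∣ i) :
    retSeq p ks i ≤ kMax ks := by
  have hr := h.2.1
  have hlt := Nat.mod_lt i (show 0 < ks.length by omega)
  refine le_kMax_of_mem ?_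
  rw [retSeq_skeleton hi (Nat.mod_mod _ _).symm, h.dropLast_eq]
  exact List.mem_map_of_mem (List.mem_range'_1.2
    ⟨Nat.pos_of_ne_zero fun h0 => hi (Nat.dvd_of_mod_eq_zero h0), by omega⟩)

/-- A cube with period below `r` lies in a copy of `β^{(2)}`, or in a copy of `β^{(2)} k β^{(2)}`
with small `k`. -/
theorem Admissible.cubeFrom_cases (h : Admissible p ks) {s m : ℕ} (hs : 0 < s)
    (hmr : m < ks.length) (hc : CubeFrom p ks s m) :
    retSeg p ks s (3 * m) <:+: beta p ks 2 ∨
      ∃ t, 0 < t ∧ (affine p ks)^[2] (retSeq p ks t) ≤ kMax ks ∧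
        retSeg p ks s (3 * m) <:+:
          beta p ks 2 ++ [(affine p ks)^[2] (retSeq p ks t)] ++ beta p ks 2 := by
  have hr := h.2.1
  -- A cube of length at most `r²` contains at most one multiple of `r²`, so two adjacent copies of
  -- `β^{(2)}` suffice.
  have hrr : 3 * m < ks.length ^ 2 + 1 := by nlinarith [sq_nonneg ((ks.length : ℤ) - 2)]
  have hpos : 0 < ks.length ^ 2 := by positivity
  obtain ⟨u, v, hv, hv', huv⟩ : ∃ u v, 0 < v ∧ v ≤ ks.length ^ 2 ∧ s = u * ks.length ^ 2 + v := by
    refine ⟨(s - 1) / ks.length ^ 2, (s - 1) % ks.length ^ 2 + 1, Nat.succ_pos _,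
      Nat.mod_lt _ hpos, ?_⟩
    have := Nat.div_add_mod (s - 1) (ks.length ^ 2)
    rw [mul_comm] at this
    omega
  rcases le_or_gt (v + 3 * m) (ks.length ^ 2) with hle | hgt
  · left
    rw [h.beta_eq, ← h.retSeg_block 2 u]
    exact retSeg_infix (by omega) (by omega)
  · right
    have e0 : (u + 1) * ks.length ^ 2 = u * ks.length ^ 2 + ks.length ^ 2 := by ring
    refine ⟨u + 1, by omega, ?_, ?_⟩
    · rw [← retSeq_mul_pow hr 2 (by omega)]
      have hdvd : ks.length ∣ (u + 1) * ks.length ^ 2 :=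
        Dvd.dvd.mul_left (dvd_pow_self _ (by omega)) _
      have hm0 : 0 < m := by
        by_contra h0
        have : m = 0 := by omega
        subst this
        omega
      have hndm : ¬ ks.length ∣ m := Nat.not_dvd_of_pos_of_lt hm0 hmr
      -- The multiple of `r²` has a partner at distance `m` inside the cube, to the right or to the
      -- left; as `0 < m < r`, the partner is not a multiple of `r`.
      rcases lt_or_ge (ks.length ^ 2) (v + 2 * m) with h1 | h1
      · have := hc ((u + 1) * ks.length ^ 2 - s) (by omega)
        rw [Nat.add_sub_cancel' (by omega)] at this
        rw [this]
        refine h.retSeq_le_kMax ?_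
        rwa [Nat.dvd_add_right hdvd]
      · have := hc ((u + 1) * ks.length ^ 2 - m - s) (by omega)
        rw [Nat.add_sub_cancel' (by omega), Nat.sub_add_cancel (by omega)] at this
        rw [← this]
        refine h.retSeq_le_kMax fun hdm => hndm ?_
        have h2 := Nat.dvd_sub hdvd hdm
        rwa [Nat.sub_sub_self (by omega)] at h2
    · rw [h.beta_concat_eq 2 (by omega), Nat.add_sub_cancel]
      exact retSeg_infix (by omega) (by omega)

end Toeplitz

/-! ### The characterisation and its decidability -/

section Decidability

variable {p : ℕ} {ks : List ℕ}

theorem Admissible.exists_short_cube_of_hasCubePlus (h : Admissible p ks)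
    (hc : HasCubePlus (sub p ks) Letter.a) :
    ∃ s m, 0 < s ∧ 0 < m ∧ m < ks.length ∧ CubeFrom p ks s m := by
  obtain ⟨n, v, hv, hvn⟩ := h.exists_cube_infix_beta hc
  rw [h.beta_eq] at hvn
  obtain ⟨t, ht, -, hct⟩ := cubeFrom_of_infix hvn
  exact h.exists_short_cube ht (List.length_pos_iff.2 hv) hct

theorem Admissible.tfae (h : Admissible p ks) :
    List.TFAE [
      PropStar p ks,
      HasCubePlus (sub p ks) Letter.a,
      ∃ v : List ℕ, RetLegal p ks v ∧ v.length < ks.length ∧ CubeInBeta p ks v,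
      ∃ v : List ℕ, v ≠ [] ∧ v.length < ks.length ∧ CubeInBeta p ks v] := by
  tfae_have 1 → 2 := PropStar.hasCubePlus
  tfae_have 2 → 3 := by
    intro hc
    obtain ⟨s, m, hs, hm, hmr, hsm⟩ := h.exists_short_cube_of_hasCubePlus hc
    refine ⟨retSeg p ks s m, ?_, by simpa using hmr, ?_⟩
    · refine h.retLegal_of_infix (n := s + m) ?_ ?_
      · rw [← List.length_pos_iff]; simpa using hm
      · rw [h.beta_eq]
        have : s + m < ks.length ^ (s + m) := Nat.lt_pow_self h.2.1
        exact retSeg_infix (by omega) (by omega)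
    · rw [CubeInBeta, hsm.retSeg_eq]
      rcases h.cubeFrom_cases hs hmr hsm with h1 | ⟨t, ht, hk, h1⟩
      · exact Or.inl h1
      · exact Or.inr ⟨_, ⟨_, h.retSeq_mem ht, rfl⟩, hk, h1⟩
  tfae_have 3 → 4 := fun ⟨v, hv, hlen, hc⟩ => ⟨v, hv.1, hlen, hc⟩
  tfae_have 4 → 1 := by
    rintro ⟨v, hv, -, hc | ⟨_, ⟨k, hk, rfl⟩, -, hc⟩⟩
    · exact h.propStar_of_hasCubePlus
        (hasCubePlus_of_legal hv hc (h.legal_of_infix_beta List.infix_rfl))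
    · exact h.propStar_of_hasCubePlus (hasCubePlus_of_legal hv hc (h.legal_beta_concat hk))
  tfae_finish

/-- Property `(∗)` is visible in a word `β^{(n)}` with explicit `n`. -/
theorem Admissible.propStar_iff_beta (h : Admissible p ks) :
    PropStar p ks ↔ ∃ v : List ℕ, v ≠ [] ∧ v ++ v ++ v <:+: beta p ks (kMax ks + 3) := by
  have hr := h.2.1
  constructor
  · intro hstar
    obtain ⟨s, m, hs, hm, hmr, hsm⟩ := h.exists_short_cube_of_hasCubePlus hstar.hasCubePlus
    refine ⟨retSeg p ks s m, by rw [← List.length_pos_iff]; simpa using hm, ?_⟩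
    rw [hsm.retSeg_eq]
    rcases h.cubeFrom_cases hs hmr hsm with h1 | ⟨t, ht, hk, h1⟩
    · exact h1.trans (infix_beta_of_le (by omega))
    -- As `k ≤ f²(k) ≤ k_max`, the same value `k` occurs at some `u < r^(k_max+1)`. The block around
    -- `u r²` ends before `(u + 1) r²`, hence within the prefix of length `r^(k_max+3) - 1`.
    · obtain ⟨u, hu, hut, hu'⟩ := h.exists_retSeq_eq ht
      refine h1.trans ?_
      rw [← hu', h.beta_concat_eq 2 hu, h.beta_eq]
      have hkt : retSeq p ks t ≤ kMax ks := ((h.le_affine _).trans (h.le_affine _)).trans hk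
      have h2 : u + 1 ≤ ks.length ^ (kMax ks + 1) :=
        Nat.succ_le_of_lt (hut.trans_le (Nat.pow_le_pow_right (by omega) (by omega)))
      have h3 := Nat.mul_le_mul_right (ks.length ^ 2) h2
      rw [← pow_add, add_assoc _ 1 2] at h3
      have hpos : 0 < ks.length ^ 2 := by positivity
      obtain ⟨w, rfl⟩ := Nat.exists_eq_add_of_le' hu
      rw [Nat.add_sub_cancel]
      change (w + 1 + 1) * _ ≤ ks.length ^ (kMax ks + 3) at h3
      have e : (w + 1 + 1) * ks.length ^ 2 = w * ks.length ^ 2 + ks.length ^ 2 + ks.length ^ 2 := by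
        ring
      exact retSeg_infix (by omega) (by omega)
  · rintro ⟨v, hv, hvn⟩
    exact h.propStar_of_hasCubePlus
      (hasCubePlus_of_legal hv hvn (h.legal_of_infix_beta List.infix_rfl))

/-- A cube in a list, located by its position and period. -/
theorem exists_cube_infix_iff (l : List ℕ) :
    (∃ v : List ℕ, v ≠ [] ∧ v ++ v ++ v <:+: l) ↔
      ∃ s < l.length, ∃ m < l.length, (l.drop s).take m ≠ [] ∧
        (l.drop s).take m ++ (l.drop s).take m ++ (l.drop s).take m =
          (l.drop s).take (m + m + m) := by
  constructor
  · rintro ⟨v, hv, x, y, rfl⟩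
    have hpos := List.length_pos_iff.2 hv
    have e : (x ++ (v ++ v ++ v) ++ y).drop x.length = v ++ v ++ v ++ y := by simp
    have e1 : (v ++ v ++ v ++ y).take v.length = v := by simp
    have e2 : (v ++ v ++ v ++ y).take (v.length + v.length + v.length) = v ++ v ++ v := by
      rw [← List.length_append, ← List.length_append, List.take_left]
    refine ⟨x.length, ?_, v.length, ?_, ?_⟩
    · simp only [List.length_append]; omega
    · simp only [List.length_append]; omega
    · rw [e, e1, e2]; exact ⟨hv, rfl⟩
  · rintro ⟨s, -, m, -, hne, heq⟩
    exact ⟨_, hne, heq ▸ (List.take_prefix _ _).isInfix.trans (List.drop_suffix _ _).isInfix⟩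

/-- There is a cube of period `m` at position `y.1` of the list `y.2`. -/
def CubeInList (m : ℕ) (y : ℕ × List ℕ) : Prop :=
  (y.2.drop y.1).take m ≠ [] ∧
    (y.2.drop y.1).take m ++ (y.2.drop y.1).take m ++ (y.2.drop y.1).take m =
      (y.2.drop y.1).take (m + m + m)

theorem primrecRel_cubeInList : PrimrecRel CubeInList := by
  have hv : Primrec fun x : ℕ × ℕ × List ℕ => (x.2.2.drop x.2.1).take x.1 :=
    Primrec.list_take.comp Primrec.fst (Primrec.list_drop.comp
      (Primrec.fst.comp Primrec.snd) (Primrec.snd.comp Primrec.snd))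
  have hw : Primrec fun x : ℕ × ℕ × List ℕ => (x.2.2.drop x.2.1).take (x.1 + x.1 + x.1) :=
    Primrec.list_take.comp (Primrec.nat_add.comp (Primrec.nat_add.comp Primrec.fst Primrec.fst)
      Primrec.fst) (Primrec.list_drop.comp
      (Primrec.fst.comp Primrec.snd) (Primrec.snd.comp Primrec.snd))
  exact (Primrec.eq.comp hv (Primrec.const [])).not.and
    (Primrec.eq.comp (Primrec.list_append.comp (Primrec.list_append.comp hv hv) hv) hw)

/-- The search over words `v` becomes a search over position and period, both bounded by the length
of the list, and bounded quantifiers preserve primitive recursiveness. -/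
theorem primrecPred_exists_cube :
    PrimrecPred fun l : List ℕ => ∃ v : List ℕ, v ≠ [] ∧ v ++ v ++ v <:+: l := by
  have hinner : PrimrecPred fun y : ℕ × List ℕ =>
      ∃ m ∈ List.range y.2.length, CubeInList m y :=
    primrecRel_cubeInList.exists_mem_list.comp
      (Primrec.list_range.comp (Primrec.list_length.comp Primrec.snd)) Primrec.id
  have hrel : PrimrecRel fun (s : ℕ) (l : List ℕ) =>
      ∃ m ∈ List.range l.length, CubeInList m (s, l) := hinner
  refine (hrel.exists_mem_list.comp (Primrec.list_range.comp Primrec.list_length)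
    Primrec.id).of_eq fun l => ?_
  rw [exists_cube_infix_iff]
  simp only [CubeInList, List.mem_range]
  rfl

theorem primrec_dropLast : Primrec (List.dropLast : List ℕ → List ℕ) := by
  refine (Primrec.list_reverse.comp (Primrec.list_tail.comp Primrec.list_reverse)).of_eq
    fun l => ?_
  simp

theorem primrec_kMax : Primrec kMax :=
  Primrec.list_foldr primrec_dropLast (Primrec.const 0)
    (Primrec.nat_max.comp (Primrec.fst.comp Primrec.snd) (Primrec.snd.comp Primrec.snd)).to₂

theorem primrec_affine : Primrec fun x : (ℕ × List ℕ) × ℕ => affine x.1.1 x.1.2 x.2 := by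
  have hl : Primrec fun l : List ℕ => l.getLastD 0 := by
    refine ((Primrec.list_getD 0).comp Primrec.list_reverse (Primrec.const 0)).of_eq fun l => ?_
    rw [List.getLastD_eq_getLast?, List.getD_eq_getElem?_getD, ← List.head?_eq_getElem?,
      List.head?_reverse]
  exact Primrec.nat_add.comp (hl.comp (Primrec.snd.comp Primrec.fst))
    (Primrec.nat_mul.comp (Primrec.fst.comp Primrec.fst) Primrec.snd)

/-- One step of the simultaneous recursion for `β^{(n)}` and `f^n(k_1), …, f^n(k_{r-1})`. -/
def betaStep (x : ℕ × List ℕ) (y : List ℕ × List ℕ) : List ℕ × List ℕ :=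
  ((y.2.flatMap fun j => y.1 ++ [j]) ++ y.1, y.2.map (affine x.1 x.2))

theorem iterate_betaStep (p : ℕ) (ks : List ℕ) (n : ℕ) :
    (betaStep (p, ks))^[n] ([], ks.dropLast) =
      (beta p ks n, ks.dropLast.map (affine p ks)^[n]) := by
  induction n with
  | zero => simp [beta]
  | succ n ih =>
    rw [Function.iterate_succ_apply', ih, betaStep, beta, List.flatMap_map, List.map_map,
      Function.iterate_succ']

theorem primrec_betaStep : Primrec₂ betaStep := by
  have h1 : Primrec fun z : (ℕ × List ℕ) × (List ℕ × List ℕ) =>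
      (z.2.2.flatMap fun j => z.2.1 ++ [j]) ++ z.2.1 :=
    Primrec.list_append.comp
      (Primrec.list_flatMap (Primrec.snd.comp Primrec.snd)
        (Primrec.list_concat.comp (Primrec.fst.comp (Primrec.snd.comp Primrec.fst))
          Primrec.snd).to₂)
      (Primrec.fst.comp Primrec.snd)
  have h2 : Primrec fun z : (ℕ × List ℕ) × (List ℕ × List ℕ) =>
      z.2.2.map (affine z.1.1 z.1.2) :=
    Primrec.list_map (Primrec.snd.comp Primrec.snd)
      (primrec_affine.comp (Primrec.pair (Primrec.fst.comp Primrec.fst) Primrec.snd)).to₂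
  exact (Primrec.pair h1 h2).to₂

theorem primrec_beta : Primrec fun x : ℕ × List ℕ => beta x.1 x.2 (kMax x.2 + 3) := by
  have := Primrec.fst.comp (Primrec.nat_iterate
    (Primrec.nat_add.comp (primrec_kMax.comp Primrec.snd) (Primrec.const 3))
    (Primrec.pair (Primrec.const ([] : List ℕ)) (primrec_dropLast.comp Primrec.snd))
    primrec_betaStep)
  refine this.of_eq fun x => ?_
  rw [show x = (x.1, x.2) from rfl, iterate_betaStep]

/-- The test searches one explicitly computed word, so the set `𝒩` in the finite check, defined
through legality, never has to be computed. -/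
theorem exists_computable_test :
    ∃ test : ℕ × List ℕ → Bool, Computable test ∧
      ∀ (p : ℕ) (ks : List ℕ), Admissible p ks → (test (p, ks) = true ↔ PropStar p ks) := by
  obtain ⟨hdec, htest⟩ := primrecPred_exists_cube.comp primrec_beta
  refine ⟨_, htest.to_comp, fun p ks h => ?_⟩
  rw [h.propStar_iff_beta, decide_eq_true_iff]

end Decidability

end SubstSchr

theorem theorem1p4 :
    -- a general almost primitive substitution on a finite alphabet
    (∀ (𝒜 : Type*) [Finite 𝒜] [TopologicalSpace 𝒜] [DiscreteTopology 𝒜]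
        [MeasurableSpace 𝒜] [DiscreteMeasurableSpace 𝒜] (ϱ : 𝒜 → List 𝒜) (a : 𝒜),
      SubstSchr.IsAlmostPrimitive ϱ a → SubstSchr.HasCubePlus ϱ a →
      ∀ (V : 𝒜 → ℝ) (ν : MeasureTheory.Measure (ℤ → 𝒜)),
        SubstSchr.IsNonatomicInvariant ϱ a ν → ∀ᵐ w ∂ν, SubstSchr.NoEigenvalues V w) ∧
    -- the two-letter family
    (∀ (p : ℕ) (ks : List ℕ), SubstSchr.Admissible p ks → SubstSchr.PropStar p ks →
      ∀ (V : SubstSchr.Letter → ℝ) (ν : MeasureTheory.Measure (ℤ → SubstSchr.Letter)),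
        SubstSchr.IsNonatomicInvariant (SubstSchr.sub p ks) SubstSchr.Letter.a ν →
        ∀ᵐ w ∂ν, SubstSchr.NoEigenvalues V w) ∧
    -- the finite check
    (∀ (p : ℕ) (ks : List ℕ), SubstSchr.Admissible p ks →
      List.TFAE [
        SubstSchr.PropStar p ks,
        SubstSchr.HasCubePlus (SubstSchr.sub p ks) SubstSchr.Letter.a,
        ∃ v : List ℕ, SubstSchr.RetLegal p ks v ∧ v.length < ks.length ∧
          SubstSchr.CubeInBeta p ks v,
        ∃ v : List ℕ, v ≠ [] ∧ v.length < ks.length ∧ SubstSchr.CubeInBeta p ks v]) ∧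
    -- one algorithm decides the property for all parameters
    (∃ test : ℕ × List ℕ → Bool, Computable test ∧
      ∀ (p : ℕ) (ks : List ℕ), SubstSchr.Admissible p ks →
        (test (p, ks) = true ↔ SubstSchr.PropStar p ks)) := by
  refine ⟨?_, ?_, fun p ks h => h.tfae, SubstSchr.exists_computable_test⟩
  · intro 𝒜 _ _ _ _ _ ϱ a h hcube V ν hν
    exact h.ae_noEigenvalues hcube V hν
  · intro p ks h hstar V ν hν
    exact h.isAlmostPrimitive.ae_noEigenvalues hstar.hasCubePlus V hν
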